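/- Let $q:\mathbb{R}\to\mathbb{R}$ be integrable, non-negative almost everywhere, and not almost everywhere zero. Consider the eigenvalue problem on $L^2(\mathbb{R})$ $$-u''(x)+\left[x^2+q(x)\right]u(x)=\lambda u(x),\qquad x\in\mathbb{R},$$ that is, an eigenvalue is a real number $\lambda$ for which there is a non-zero $u\in L^2(\mathbb{R})$, with $u$ differentiable and $u'$ locally absolutely continuous, satisfying the equation almost everywhere. Then the eigenvalues, repeated according to multiplicity, form a non-decreasing sequence $\lambda_0\le\lambda_1\le\dots\to\infty$. Put $\lambda_k^0:=2k+1$, the eigenvalues of the unperturbed problem $q=0$, and $$\omega_n:=\begin{cases}\dfrac{2n+3}{n+1}\,\dfrac{\Gamma\left(\frac n2+1\right)}{\Gamma\left(\frac{n+1}{2}\right)}, & n\text{ odd},\\[3mm] (n+1)\,\dfrac{\Gamma\left(\frac{n+1}{2}\right)}{\Gamma\left(\frac n2+1\right)}, & n\text{ even}.\end{cases}$$ Then $\lambda_k>\lambda_k^0$ for all $k\ge 0$, and for all integers $n\ge 0$ and all real $s>0$, $$\frac{1}{n+1}\sum_{k=0}^n\left(\lambda_k-\lambda_k^0\right)^{-s}\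 \ge\ \left[\frac{\omega_n}{(n+1)\pi}\int_{\mathbb{R}}q(x)\,dx\right]^{-s}.$$ -/

import Mathlib

open MeasureTheory Filter

/-- The `L²(ℝ)` solutions of the eigenvalue equation `-u'' + V u = μ u` on the real line:
`u` is differentiable, `u'` is locally absolutely continuous (absolutely continuous on every
compact interval), the equation holds almost everywhere, and `u` is square integrable.
The nonzero such `u` are the eigenfunctions of the Schrödinger operator `-d²/dx² + V` on `L²(ℝ)`
for the eigenvalue `μ`. -/
structure IsSchrodingerL2Solution (V : ℝ → ℝ) (μ : ℝ) (u : ℝ → ℝ) : Prop where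
  differentiable : Differentiable ℝ u
  absolutelyContinuous_deriv : ∀ a b : ℝ, AbsolutelyContinuousOnInterval (deriv u) a b
  /-- `u''(x)` exists and `-u''(x) + V(x) u(x) = μ u(x)`, for almost every `x`. -/
  equation : ∀ᵐ x : ℝ, DifferentiableAt ℝ (deriv u) x ∧
    -(deriv (deriv u) x) + V x * u x = μ * u x
  memLp : MemLp u 2 volume

/-- The eigenspace of `-d²/dx² + V` on `L²(ℝ)` for `μ`; it is zero unless `μ` is an eigenvalue. -/
def schrodingerEigenspace (V : ℝ → ℝ) (μ : ℝ) : Submodule ℝ (ℝ → ℝ) where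
  carrier := {u | IsSchrodingerL2Solution V μ u}
  zero_mem' := by
    have h0 : deriv (0 : ℝ → ℝ) = 0 := by ext x; simp
    refine ⟨differentiable_const 0, fun a b => ?_, ?_, MemLp.zero⟩
    · rw [h0]
      exact (contDiff_const (c := (0 : ℝ))).contDiffOn.absolutelyContinuousOnInterval
    · refine Eventually.of_forall fun x => ?_
      rw [h0, h0]
      exact ⟨differentiableAt_const 0, by simp⟩
  add_mem' := by
    intro u v hu hv
    have h : deriv (u + v) = deriv u + deriv v := by
      ext x
      exact deriv_add (hu.differentiable x) (hv.differentiable x)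
    refine ⟨hu.differentiable.add hv.differentiable, fun a b => ?_, ?_, hu.memLp.add hv.memLp⟩
    · rw [h]
      exact (hu.absolutelyContinuous_deriv a b).add (hv.absolutelyContinuous_deriv a b)
    · filter_upwards [hu.equation, hv.equation] with x hx hy
      rw [h]
      refine ⟨hx.1.add hy.1, ?_⟩
      rw [deriv_add hx.1 hy.1, Pi.add_apply]
      linear_combination hx.2 + hy.2
  smul_mem' := by
    intro c u hu
    have h : deriv (c • u) = c • deriv u := by
      ext x
      exact deriv_const_smul c (hu.differentiable x)
    refine ⟨hu.differentiable.const_smul c, fun a b => ?_, ?_, hu.memLp.const_smul c⟩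
    · rw [h]
      exact (hu.absolutelyContinuous_deriv a b).const_smul c
    · filter_upwards [hu.equation] with x hx
      rw [h]
      refine ⟨hx.1.const_smul c, ?_⟩
      rw [deriv_const_smul c hx.1, Pi.smul_apply, smul_eq_mul, smul_eq_mul]
      linear_combination c * hx.2

/-- `lam 0 ≤ lam 1 ≤ … → ∞` is the list of all eigenvalues of `-d²/dx² + V` on `L²(ℝ)`,
each repeated according to its multiplicity: every real number `μ` occurs in the list exactly
as often as the dimension of its eigenspace. -/
structure IsSchrodingerEigenvalueSequence (V : ℝ → ℝ) (lam : ℕ → ℝ) : Prop where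
  monotone : Monotone lam
  tendsto_atTop : Tendsto lam atTop atTop
  multiplicity : ∀ μ : ℝ,
    Cardinal.mk {k : ℕ // lam k = μ} = Module.rank ℝ (schrodingerEigenspace V μ)

/-- The eigenvalues `2 k + 1` of the quantum harmonic oscillator `-u'' + x² u = λ u`. -/
def harmonicEigenvalue (k : ℕ) : ℝ := 2 * (k : ℝ) + 1

/-- The constants `ω_n`, given by quotients of Gamma functions. -/
noncomputable def omegaConst (n : ℕ) : ℝ :=
  if Odd n then
    (2 * (n : ℝ) + 3) / ((n : ℝ) + 1) *
      (Real.Gamma ((n : ℝ) / 2 + 1) / Real.Gamma (((n : ℝ) + 1) / 2))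
  else
    ((n : ℝ) + 1) * (Real.Gamma (((n : ℝ) + 1) / 2) / Real.Gamma ((n : ℝ) / 2 + 1))

/-!
The quadratic form of `H = -d²/dx² + x² + q` dominates that of the harmonic oscillator, whose
energy is `∑_k (2 k + 1) ⟨u, h_k⟩²` in the basis of Hermite functions `h_k`. Hence the form domain
embeds compactly into `L²`, and the spectral theorem for this embedding composed with its adjoint
gives a complete system of weak eigenfunctions of `H`, which are classical ones by the
du Bois-Reymond lemma. All eigenvalues are simple, as the Wronskian of two `L²` solutions of the
equation is constant and integrable, hence zero.

For the lower bound, a nonzero combination of eigenfunctions for `n + 1` eigenvalues is orthogonal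
to `h_0, …, h_{n-1}`, so that its oscillator energy is at least `2 n + 1` times its square norm; the
potential adds a positive amount because an eigenfunction has only countably many zeros.

For the sum, let `e_j` be the normalized eigenfunctions. The weights `∑_{k ≤ n} ⟨h_k, e_j⟩²` lie in
`[0, 1]` and add up to `n + 1`. Since the `λ_j` increase, `∑_{j ≤ n} λ_j` is at most their weighted
sum, which is at most `∑_{k ≤ n} (2 k + 1) + ∫ q ∑_{k ≤ n} h_k²`. The function
`2 ∑_{k ≤ n} h_k² + h_{n+1}²` has derivative `-2 x h_{n+1}²`, so it is largest at `0`, and its value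
there is `2 ω_n / π`. Jensen's inequality then bounds the mean of `(λ_k - (2 k + 1)) ^ (-s)`.
-/

open scoped Topology ContDiff

/-! ### Locally absolutely continuous functions -/

theorem intervalIntegrable_of_locallyIntegrable {E : Type*} [NormedAddCommGroup E] {g : ℝ → E}
    {μ : Measure ℝ} (hg : LocallyIntegrable g μ) (a b : ℝ) : IntervalIntegrable g μ a b :=
  intervalIntegrable_iff.mpr
    ((hg.integrableOn_isCompact isCompact_uIcc).mono_set Set.uIoc_subset_uIcc)

/-- `f` is locally absolutely continuous on the line with derivative `g` almost everywhere. -/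
structure IsLocalPrimitive (f g : ℝ → ℝ) : Prop where
  locallyIntegrable : LocallyIntegrable g volume
  sub_eq_integral : ∀ a b : ℝ, f b - f a = ∫ x in a..b, g x

namespace IsLocalPrimitive

variable {f g f₁ g₁ : ℝ → ℝ}

theorem of_absolutelyContinuous (hf : ∀ a b : ℝ, AbsolutelyContinuousOnInterval f a b) :
    IsLocalPrimitive f (deriv f) := by
  refine ⟨fun x => ?_, fun a b => (hf a b).integral_deriv_eq_sub.symm⟩
  have hint : IntegrableOn (deriv f) (Set.Icc (x - 1) (x + 1)) :=
    (intervalIntegrable_iff_integrableOn_Icc_of_le (by linarith)).1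
      (hf (x - 1) (x + 1)).intervalIntegrable_deriv
  exact ⟨_, Icc_mem_nhds (by linarith) (by linarith), hint⟩

theorem of_hasDerivAt (hf : ∀ x, HasDerivAt f (g x) x) (hg : Continuous g) :
    IsLocalPrimitive f g :=
  ⟨hg.locallyIntegrable, fun a b =>
    (intervalIntegral.integral_eq_sub_of_hasDerivAt (fun x _ => hf x)
      (hg.intervalIntegrable a b)).symm⟩

theorem integral (hg : LocallyIntegrable g volume) (a : ℝ) :
    IsLocalPrimitive (fun x => ∫ t in a..x, g t) g :=
  ⟨hg, fun _ _ => intervalIntegral.integral_interval_sub_left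
    (intervalIntegrable_of_locallyIntegrable hg _ _)
    (intervalIntegrable_of_locallyIntegrable hg _ _)⟩

theorem congr (h : IsLocalPrimitive f g) (hg : g =ᵐ[volume] g₁) : IsLocalPrimitive f g₁ := by
  refine ⟨h.locallyIntegrable.congr hg, fun a b => ?_⟩
  rw [h.sub_eq_integral]
  exact intervalIntegral.integral_congr_ae (hg.mono fun x hx _ => hx)

theorem of_ae_hasDerivAt (hf : ∀ a b : ℝ, AbsolutelyContinuousOnInterval f a b)
    (hg : ∀ᵐ x, HasDerivAt f (g x) x) : IsLocalPrimitive f g :=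
  (of_absolutelyContinuous hf).congr (hg.mono fun _ hx => hx.deriv)

theorem intervalIntegrable (h : IsLocalPrimitive f g) (a b : ℝ) :
    IntervalIntegrable g volume a b :=
  intervalIntegrable_of_locallyIntegrable h.locallyIntegrable a b

theorem eq_add (h : IsLocalPrimitive f g) (a : ℝ) : f = fun x => f a + ∫ t in a..x, g t := by
  ext x
  rw [← h.sub_eq_integral a x, add_sub_cancel]

theorem absolutelyContinuousOnInterval (h : IsLocalPrimitive f g) (a b : ℝ) :
    AbsolutelyContinuousOnInterval f a b := by
  have hprim := (h.intervalIntegrable a b).absolutelyContinuousOnInterval_intervalIntegral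
    (c := a) (by simp)
  have hconst : AbsolutelyContinuousOnInterval (fun _ : ℝ => f a) a b :=
    (contDiff_const (c := f a)).contDiffOn.absolutelyContinuousOnInterval
  rw [h.eq_add a]
  exact hconst.add hprim

theorem ae_hasDerivAt (h : IsLocalPrimitive f g) : ∀ᵐ x, HasDerivAt f (g x) x := by
  filter_upwards [LocallyIntegrable.ae_hasDerivAt_integral h.locallyIntegrable] with x hx
  rw [h.eq_add 0]
  exact (hx 0).const_add (f 0)

theorem continuous (h : IsLocalPrimitive f g) : Continuous f := by
  rw [h.eq_add 0]
  exact continuous_const.add (intervalIntegral.continuous_primitive h.intervalIntegrable 0)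

theorem hasDerivAt (h : IsLocalPrimitive f g) (hg : Continuous g) (x : ℝ) :
    HasDerivAt f (g x) x := by
  rw [h.eq_add 0]
  exact (intervalIntegral.integral_hasDerivAt_right (h.intervalIntegrable 0 x)
    (hg.stronglyMeasurableAtFilter _ _) hg.continuousAt).const_add (f 0)

theorem add (h : IsLocalPrimitive f g) (h₁ : IsLocalPrimitive f₁ g₁) :
    IsLocalPrimitive (fun x => f x + f₁ x) (fun x => g x + g₁ x) := by
  refine ⟨h.locallyIntegrable.add h₁.locallyIntegrable, fun a b => ?_⟩
  rw [intervalIntegral.integral_add (h.intervalIntegrable a b) (h₁.intervalIntegrable a b),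
    ← h.sub_eq_integral, ← h₁.sub_eq_integral]
  ring

theorem const_add (h : IsLocalPrimitive f g) (c : ℝ) : IsLocalPrimitive (fun x => c + f x) g :=
  ⟨h.locallyIntegrable, fun a b => by rw [← h.sub_eq_integral]; ring⟩

theorem const_mul (h : IsLocalPrimitive f g) (c : ℝ) :
    IsLocalPrimitive (fun x => c * f x) (fun x => c * g x) := by
  refine ⟨h.locallyIntegrable.smul c, fun a b => ?_⟩
  rw [intervalIntegral.integral_const_mul, ← h.sub_eq_integral]
  ring

theorem sub (h : IsLocalPrimitive f g) (h₁ : IsLocalPrimitive f₁ g₁) :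
    IsLocalPrimitive (fun x => f x - f₁ x) (fun x => g x - g₁ x) := by
  simpa [sub_eq_add_neg] using h.add (h₁.const_mul (-1))

theorem mul (h : IsLocalPrimitive f g) (h₁ : IsLocalPrimitive f₁ g₁) :
    IsLocalPrimitive (fun x => f x * f₁ x) (fun x => g x * f₁ x + f x * g₁ x) := by
  refine of_ae_hasDerivAt (fun a b =>
    (h.absolutelyContinuousOnInterval a b).mul (h₁.absolutelyContinuousOnInterval a b)) ?_
  filter_upwards [h.ae_hasDerivAt, h₁.ae_hasDerivAt] with x hx hx₁
  exact hx.mul hx₁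

theorem integral_eq_zero (h : IsLocalPrimitive f g) (hg : Integrable g volume)
    (hf : Integrable f volume) : ∫ x, g x = 0 := by
  have hlim : Tendsto (fun x : ℝ => f x - f (-x)) atTop (𝓝 (∫ x, g x)) :=
    (intervalIntegral_tendsto_integral hg tendsto_neg_atTop_atBot tendsto_id).congr
      fun x => (h.sub_eq_integral (-x) x).symm
  refine IntegrableAtFilter.eq_zero_of_tendsto (μ := volume)
    ((hf.sub hf.comp_neg).integrableAtFilter atTop) (fun s hs => ?_) hlim
  obtain ⟨a, ha⟩ := mem_atTop_sets.1 hs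
  exact measure_mono_top (s₁ := Set.Ici a) (fun x hx => ha x hx) Real.volume_Ici

theorem exists_bound (h : IsLocalPrimitive f g) (hg : Integrable g volume) :
    ∃ C, ∀ x, |f x| ≤ C := by
  refine ⟨|f 0| + ∫ x, |g x|, fun x => ?_⟩
  rw [congrFun (h.eq_add 0) x]
  refine (abs_add_le _ _).trans (add_le_add_right ?_ _)
  refine (intervalIntegral.norm_integral_le_integral_norm_uIoc (f := g)).trans ?_
  exact setIntegral_le_integral hg.norm (Eventually.of_forall fun x => norm_nonneg _)

theorem eq_of_ae_eq_zero (h : IsLocalPrimitive f g) (hg : g =ᵐ[volume] 0) (a b : ℝ) :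
    f a = f b := by
  have hint : ∫ x in a..b, g x = 0 :=
    intervalIntegral.integral_zero_ae (hg.mono fun x hx _ => hx)
  linarith [h.sub_eq_integral a b]

section Gronwall

variable {F G k : ℝ → ℝ}

theorem eq_zero_on_Icc_of_abs_le_mul (h : IsLocalPrimitive F G) (hF : ∀ x, 0 ≤ F x)
    (hk : LocallyIntegrable k volume) (hk_nonneg : ∀ x, 0 ≤ k x)
    (hG : ∀ᵐ x, |G x| ≤ k x * F x) {a b y : ℝ} (hy : y ∈ Set.Icc a b) (hFy : F y = 0)
    (hsmall : ∀ z ∈ Set.Icc a b, |∫ t in y..z, k t| < 1) : ∀ x ∈ Set.Icc a b, F x = 0 := by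
  obtain ⟨z, hz, hmax⟩ := isCompact_Icc.exists_isMaxOn ⟨y, hy⟩ h.continuous.continuousOn
  have hFz_le : F z ≤ |∫ t in y..z, k t| * F z :=
    calc F z = |∫ t in y..z, G t| := by
          rw [← h.sub_eq_integral, hFy, sub_zero, abs_of_nonneg (hF z)]
      _ ≤ |∫ t in y..z, k t * F z| := by
          refine intervalIntegral.norm_integral_le_abs_of_norm_le (f := G)
            (g := fun t => k t * F z) ?_
            ((intervalIntegrable_of_locallyIntegrable hk _ _).mul_const _)
          rw [ae_restrict_iff' measurableSet_uIoc]
          filter_upwards [hG] with t ht ht_mem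
          exact ht.trans (mul_le_mul_of_nonneg_left
            (hmax (Set.uIcc_subset_Icc hy hz (Set.uIoc_subset_uIcc ht_mem))) (hk_nonneg t))
      _ = |∫ t in y..z, k t| * F z := by
          rw [intervalIntegral.integral_mul_const, abs_mul, abs_of_nonneg (hF z)]
  have hFz : F z = 0 := by nlinarith [hF z, hsmall z hz]
  exact fun x hx => le_antisymm ((hmax hx).trans hFz.le) (hF x)

theorem eq_zero_of_abs_le_mul (h : IsLocalPrimitive F G) (hF : ∀ x, 0 ≤ F x)
    (hk : LocallyIntegrable k volume) (hk_nonneg : ∀ x, 0 ≤ k x)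
    (hG : ∀ᵐ x, |G x| ≤ k x * F x) {x₀ : ℝ} (hx₀ : F x₀ = 0) (x : ℝ) : F x = 0 := by
  have hclosed : IsClosed {x | F x = 0} := isClosed_eq h.continuous continuous_const
  have hopen : IsOpen {x | F x = 0} := by
    refine isOpen_iff_mem_nhds.2 fun y hy => ?_
    obtain ⟨δ, hδ, hsmall⟩ := Metric.continuousAt_iff.1
      ((integral hk y).continuous.continuousAt (x := y)) 1 one_pos
    refine mem_of_superset (Icc_mem_nhds (show y - δ / 2 < y by linarith)
      (show y < y + δ / 2 by linarith)) ?_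
    refine h.eq_zero_on_Icc_of_abs_le_mul hF hk hk_nonneg hG
      ⟨by linarith, by linarith⟩ hy fun z hz => ?_
    have hdist : dist z y < δ := by
      rw [Real.dist_eq, abs_lt]
      constructor <;> linarith [hz.1, hz.2]
    simpa [Real.dist_eq] using hsmall hdist
  exact Set.eq_univ_iff_forall.1 (IsClopen.eq_univ ⟨hclosed, hopen⟩ ⟨x₀, hx₀⟩) x

end Gronwall

theorem eq_zero_of_initial_eq_zero {u v w W : ℝ → ℝ} (hu : IsLocalPrimitive u v)
    (hv : IsLocalPrimitive v w) (hW : LocallyIntegrable W volume)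
    (hw : ∀ᵐ x, w x = W x * u x) {x₀ : ℝ} (hu₀ : u x₀ = 0) (hv₀ : v x₀ = 0) (x : ℝ) :
    u x = 0 := by
  have hsq := (hu.mul hu).add (hv.mul hv)
  have henergy : u x * u x + v x * v x = 0 := by
    refine hsq.eq_zero_of_abs_le_mul (k := fun x => 1 + ‖W x‖)
      (fun x => add_nonneg (mul_self_nonneg _) (mul_self_nonneg _))
      ((locallyIntegrable_const 1).add fun x => (hW x).norm) (fun x => by positivity) ?_
      (x₀ := x₀) (by simp [hu₀, hv₀]) x
    filter_upwards [hw] with x hx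
    rw [hx]
    calc |v x * u x + u x * v x + (W x * u x * v x + v x * (W x * u x))|
        = |1 + W x| * |2 * u x * v x| := by rw [← abs_mul]; ring_nf
      _ ≤ (1 + ‖W x‖) * (u x * u x + v x * v x) := by
          refine mul_le_mul ((abs_add_le _ _).trans (by simp)) ?_ (abs_nonneg _) (by positivity)
          rw [abs_le]
          constructor <;> nlinarith [sq_nonneg (u x + v x), sq_nonneg (u x - v x)]
  nlinarith [mul_self_nonneg (u x), mul_self_nonneg (v x)]

end IsLocalPrimitive

/-! ### Hermite functions -/

section HermiteFunctions

open Polynomial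
open scoped Nat

theorem derivative_hermite_succ (k : ℕ) :
    derivative (hermite (k + 1)) = ((k + 1 : ℕ) : ℤ[X]) * hermite k := by
  induction k with
  | zero => simp
  | succ k ih =>
    rw [hermite_succ (k + 1), derivative_sub, derivative_mul, derivative_X, ih, derivative_mul,
      derivative_natCast, hermite_succ k]
    push_cast
    ring

/-- The Hermite polynomials in the normalization that makes the Hermite functions orthonormal:
in the physicists' convention, `H_k / √(2 ^ k * k! * √π)`. -/
noncomputable def normalizedHermite (k : ℕ) : ℝ[X] :=
  C (√(k ! * √Real.pi))⁻¹ * ((hermite k).map (Int.castRingHom ℝ)).comp (C √2 * X)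

theorem sqrt_mul_inv_sqrt_factorial_succ (k : ℕ) :
    √(2 * (k + 1 : ℝ)) * (√((k + 1)! * √Real.pi))⁻¹ = √2 * (√(k ! * √Real.pi))⁻¹ := by
  rw [Nat.factorial_succ, Nat.cast_mul, mul_assoc, Nat.cast_add_one,
    Real.sqrt_mul (by positivity : (0 : ℝ) ≤ k + 1), Real.sqrt_mul zero_le_two]
  have : √(k + 1 : ℝ) ≠ 0 := by positivity
  field_simp

theorem normalizedHermite_succ (k : ℕ) :
    C √(2 * (k + 1 : ℝ)) * normalizedHermite (k + 1) =
      2 * X * normalizedHermite k - derivative (normalizedHermite k) := by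
  have hsqrt : (C √2 * C √2 : ℝ[X]) = 2 := by
    rw [← C_mul, Real.mul_self_sqrt zero_le_two, map_ofNat]
  rw [normalizedHermite, ← mul_assoc, ← C_mul, sqrt_mul_inv_sqrt_factorial_succ, hermite_succ]
  simp only [normalizedHermite, derivative_C_mul, derivative_comp, derivative_map,
    Polynomial.map_sub, Polynomial.map_mul, map_X, sub_comp, mul_comp, X_comp, C_mul,
    derivative_X, mul_one]
  linear_combination (C (√(k ! * √Real.pi))⁻¹ * X *
    ((hermite k).map (Int.castRingHom ℝ)).comp (C √2 * X)) * hsqrt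

theorem derivative_normalizedHermite_succ (k : ℕ) :
    derivative (normalizedHermite (k + 1)) = C √(2 * (k + 1 : ℝ)) * normalizedHermite k := by
  have hcoeff : (√((k + 1)! * √Real.pi))⁻¹ * √2 * (k + 1) =
      √(2 * (k + 1 : ℝ)) * (√(k ! * √Real.pi))⁻¹ := by
    have h := congrArg (√(2 * (k + 1 : ℝ)) * ·) (sqrt_mul_inv_sqrt_factorial_succ k)
    simp only [← mul_assoc, Real.mul_self_sqrt (by positivity : (0 : ℝ) ≤ 2 * (k + 1))] at h
    have hsqrt : √2 * √2 = (2 : ℝ) := Real.mul_self_sqrt zero_le_two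
    linear_combination √2 / 2 * h +
      √(2 * (k + 1 : ℝ)) * (√(k ! * √Real.pi))⁻¹ / 2 * hsqrt
  have hmap : ((hermite k).map (Int.castRingHom ℝ)).comp (C √2 * X) *
      (C ((√((k + 1)! * √Real.pi))⁻¹ * √2 * (k + 1))) =
      ((hermite k).map (Int.castRingHom ℝ)).comp (C √2 * X) *
        C (√(2 * (k + 1 : ℝ)) * (√(k ! * √Real.pi))⁻¹) := by rw [hcoeff]
  simp only [normalizedHermite, derivative_C_mul, derivative_comp, derivative_map,
    derivative_hermite_succ, Polynomial.map_mul, Polynomial.map_natCast, mul_comp, natCast_comp,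
    derivative_X, mul_one]
  simp only [C_mul, C_add, C_1, map_natCast] at hmap
  push_cast
  linear_combination hmap

/-- The Hermite functions, the orthonormal basis of eigenfunctions of the harmonic oscillator. -/
noncomputable def hermiteFun (k : ℕ) (x : ℝ) : ℝ :=
  (normalizedHermite k).eval x * Real.exp (-(1 / 2) * x ^ 2)

theorem hermiteFun_zero (x : ℝ) :
    hermiteFun 0 x = (√(√Real.pi))⁻¹ * Real.exp (-(1 / 2) * x ^ 2) := by
  simp [hermiteFun, normalizedHermite]

theorem hasDerivAt_eval_mul_gaussian (p : ℝ[X]) (x : ℝ) :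
    HasDerivAt (fun x : ℝ => p.eval x * Real.exp (-(1 / 2) * x ^ 2))
      ((derivative p - X * p).eval x * Real.exp (-(1 / 2) * x ^ 2)) x := by
  convert! (p.hasDerivAt x).mul (((hasDerivAt_pow 2 x).const_mul (-(1 / 2) : ℝ)).exp) using 1
  simp only [eval_sub, eval_mul, eval_X]
  push_cast
  ring

theorem hasDerivAt_hermiteFun (k : ℕ) (x : ℝ) : HasDerivAt (hermiteFun k)
    (x * hermiteFun k x - √(2 * (k + 1 : ℝ)) * hermiteFun (k + 1) x) x := by
  convert! hasDerivAt_eval_mul_gaussian (normalizedHermite k) x using 1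
  have h := congrArg (eval x) (normalizedHermite_succ k)
  simp only [eval_mul, eval_C, eval_sub, eval_X, eval_ofNat] at h
  simp only [hermiteFun, eval_sub, eval_mul, eval_X]
  linear_combination -Real.exp (-(1 / 2) * x ^ 2) * h

theorem deriv_hermiteFun (k : ℕ) (x : ℝ) : deriv (hermiteFun k) x =
    x * hermiteFun k x - √(2 * (k + 1 : ℝ)) * hermiteFun (k + 1) x :=
  (hasDerivAt_hermiteFun k x).deriv

theorem deriv_hermiteFun_succ (k : ℕ) (x : ℝ) : deriv (hermiteFun (k + 1)) x =
    -x * hermiteFun (k + 1) x + √(2 * (k + 1 : ℝ)) * hermiteFun k x := by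
  refine (hasDerivAt_eval_mul_gaussian (normalizedHermite (k + 1)) x).deriv.trans ?_
  rw [derivative_normalizedHermite_succ]
  simp only [hermiteFun, eval_sub, eval_mul, eval_C, eval_X]
  ring

theorem deriv_hermiteFun_zero (x : ℝ) : deriv (hermiteFun 0) x = -x * hermiteFun 0 x := by
  refine (hasDerivAt_eval_mul_gaussian (normalizedHermite 0) x).deriv.trans ?_
  have hconst : derivative (normalizedHermite 0) = 0 := by simp [normalizedHermite]
  simp only [hconst, zero_sub, hermiteFun, eval_neg, eval_mul, eval_X]
  ring

theorem hermiteFun_one (x : ℝ) : √2 * hermiteFun 1 x = 2 * x * hermiteFun 0 x := by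
  have h := (deriv_hermiteFun 0 x).symm.trans (deriv_hermiteFun_zero x)
  norm_num at h
  linarith

theorem hermiteFun_recurrence (k : ℕ) (x : ℝ) :
    √(2 * (k + 2 : ℝ)) * hermiteFun (k + 2) x =
      2 * x * hermiteFun (k + 1) x - √(2 * (k + 1 : ℝ)) * hermiteFun k x := by
  have h := (deriv_hermiteFun (k + 1) x).symm.trans (deriv_hermiteFun_succ k x)
  push_cast at h
  rw [show (k : ℝ) + 1 + 1 = k + 2 by ring] at h
  linarith

theorem continuous_hermiteFun (k : ℕ) : Continuous (hermiteFun k) := by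
  unfold hermiteFun
  fun_prop

theorem differentiable_hermiteFun (k : ℕ) : Differentiable ℝ (hermiteFun k) :=
  fun x => (hasDerivAt_hermiteFun k x).differentiableAt

theorem continuous_deriv_hermiteFun (k : ℕ) : Continuous (deriv (hermiteFun k)) := by
  have hcont := continuous_hermiteFun k
  have hcont_succ := continuous_hermiteFun (k + 1)
  rw [funext (deriv_hermiteFun k)]
  fun_prop

theorem integrable_eval_mul_gaussian (p : ℝ[X]) {b : ℝ} (hb : 0 < b) :
    Integrable (fun x : ℝ => p.eval x * Real.exp (-b * x ^ 2)) volume := by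
  induction p using Polynomial.induction_on' with
  | add p r hp hr =>
    simp only [eval_add, add_mul]
    exact hp.add hr
  | monomial n a =>
    simp only [eval_monomial, mul_assoc]
    refine Integrable.const_mul ?_ a
    simpa using integrable_rpow_mul_exp_neg_mul_sq hb
      (show (-1 : ℝ) < n from neg_one_lt_zero.trans_le n.cast_nonneg)

theorem memLp_eval_mul_gaussian (p : ℝ[X]) :
    MemLp (fun x : ℝ => p.eval x * Real.exp (-(1 / 2) * x ^ 2)) 2 volume := by
  have hcont : Continuous fun x : ℝ => p.eval x * Real.exp (-(1 / 2) * x ^ 2) := by fun_prop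
  refine (memLp_two_iff_integrable_sq hcont.aestronglyMeasurable).2 ?_
  convert! integrable_eval_mul_gaussian (p ^ 2) one_pos using 2 with x
  rw [mul_pow, ← Real.exp_nat_mul, eval_pow]
  congr 2
  push_cast
  ring

theorem memLp_pow_mul_hermiteFun (m k : ℕ) :
    MemLp (fun x => x ^ m * hermiteFun k x) 2 volume := by
  convert! memLp_eval_mul_gaussian (X ^ m * normalizedHermite k) using 2 with x
  simp only [hermiteFun, eval_mul, eval_pow, eval_X]
  ring

theorem memLp_hermiteFun (k : ℕ) : MemLp (hermiteFun k) 2 volume :=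
  memLp_eval_mul_gaussian _

end HermiteFunctions

section HermiteKernel

theorem hasDerivAt_sum_hermiteFun_sq (n : ℕ) (x : ℝ) :
    HasDerivAt (fun x => ∑ k ∈ Finset.range (n + 1), hermiteFun k x ^ 2)
      (-√(2 * (n + 1 : ℝ)) * hermiteFun n x * hermiteFun (n + 1) x) x := by
  have hsq (k : ℕ) : HasDerivAt (fun x => hermiteFun k x ^ 2)
      (2 * hermiteFun k x * deriv (hermiteFun k) x) x := by
    simpa using ((differentiable_hermiteFun k x).hasDerivAt.fun_pow 2)
  induction n with
  | zero =>
    simp only [zero_add, Finset.sum_range_one]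
    refine (hsq 0).congr_deriv ?_
    rw [deriv_hermiteFun_zero]
    norm_num
    linear_combination -hermiteFun 0 x * hermiteFun_one x
  | succ n ih =>
    simp only [Finset.sum_range_succ _ (n + 1)]
    refine (ih.add (hsq (n + 1))).congr_deriv ?_
    push_cast
    have h := deriv_hermiteFun (n + 1) x
    push_cast at h
    linear_combination hermiteFun (n + 1) x * (h + deriv_hermiteFun_succ n x)

theorem le_apply_zero_of_mul_deriv_nonpos {f : ℝ → ℝ} (hf : Differentiable ℝ f)
    (h : ∀ x, x * deriv f x ≤ 0) (x : ℝ) : f x ≤ f 0 := by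
  rcases le_total 0 x with hx | hx
  · refine antitoneOn_of_deriv_nonpos (convex_Ici 0) hf.continuous.continuousOn
      hf.differentiableOn (fun y hy => ?_) Set.self_mem_Ici hx hx
    rw [interior_Ici] at hy
    exact nonpos_of_mul_nonpos_right (h y) hy
  · refine monotoneOn_of_deriv_nonneg (convex_Iic 0) hf.continuous.continuousOn
      hf.differentiableOn (fun y hy => ?_) hx Set.self_mem_Iic hx
    rw [interior_Iic] at hy
    exact nonneg_of_mul_nonpos_right (h y) hy

theorem two_mul_sum_hermiteFun_sq_add_sq_le (n : ℕ) (x : ℝ) :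
    2 * ∑ k ∈ Finset.range (n + 1), hermiteFun k x ^ 2 + hermiteFun (n + 1) x ^ 2 ≤
      2 * ∑ k ∈ Finset.range (n + 1), hermiteFun k 0 ^ 2 + hermiteFun (n + 1) 0 ^ 2 := by
  have hderiv (x : ℝ) : HasDerivAt
      (fun x => 2 * ∑ k ∈ Finset.range (n + 1), hermiteFun k x ^ 2 + hermiteFun (n + 1) x ^ 2)
      (-2 * x * hermiteFun (n + 1) x ^ 2) x := by
    refine (((hasDerivAt_sum_hermiteFun_sq n x).const_mul 2).add
      ((differentiable_hermiteFun (n + 1) x).hasDerivAt.fun_pow 2)).congr_deriv ?_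
    rw [deriv_hermiteFun_succ]
    push_cast
    ring
  refine le_apply_zero_of_mul_deriv_nonpos (fun x => (hderiv x).differentiableAt) (fun x => ?_) x
  rw [(hderiv x).deriv]
  nlinarith [sq_nonneg (x * hermiteFun (n + 1) x)]

theorem hermiteFun_one_apply_zero : hermiteFun 1 0 = 0 := by
  simpa using hermiteFun_one 0

theorem hermiteFun_add_two_apply_zero_sq (k : ℕ) :
    (k + 2 : ℝ) * hermiteFun (k + 2) 0 ^ 2 = (k + 1) * hermiteFun k 0 ^ 2 := by
  have h := congrArg (· ^ 2) (hermiteFun_recurrence k 0)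
  simp only [mul_zero, zero_mul, zero_sub, neg_sq, mul_pow] at h
  rw [Real.sq_sqrt (by positivity), Real.sq_sqrt (by positivity)] at h
  linarith

theorem sum_hermiteFun_apply_zero_sq (n : ℕ) :
    ∑ k ∈ Finset.range (n + 1), hermiteFun k 0 ^ 2 =
      (n + 1 : ℝ) * (hermiteFun n 0 ^ 2 + hermiteFun (n + 1) 0 ^ 2) := by
  induction n with
  | zero => simp [hermiteFun_one_apply_zero]
  | succ n ih =>
    rw [Finset.sum_range_succ, ih]
    push_cast
    linear_combination -hermiteFun_add_two_apply_zero_sq n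

theorem hermiteFun_odd_apply_zero (m : ℕ) : hermiteFun (2 * m + 1) 0 = 0 := by
  induction m with
  | zero => exact hermiteFun_one_apply_zero
  | succ m ih =>
    have h := hermiteFun_add_two_apply_zero_sq (2 * m + 1)
    rw [ih] at h
    rw [show 2 * (m + 1) + 1 = 2 * m + 1 + 2 by ring]
    exact pow_eq_zero_iff two_ne_zero |>.1
      ((mul_eq_zero.1 (h.trans (by simp))).resolve_left (by positivity))

theorem hermiteFun_even_apply_zero_sq (m : ℕ) : hermiteFun (2 * m) 0 ^ 2 =
    Real.Gamma ((m : ℝ) + 1 / 2) / (Real.pi * Real.Gamma ((m : ℝ) + 1)) := by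
  induction m with
  | zero =>
    have hpi : √Real.pi * √Real.pi = Real.pi := Real.mul_self_sqrt Real.pi_pos.le
    simp only [mul_zero, hermiteFun_zero, Nat.cast_zero, zero_add, Real.Gamma_one,
      Real.Gamma_one_half_eq]
    rw [mul_pow, inv_pow, Real.sq_sqrt (Real.sqrt_nonneg _)]
    field_simp
    simp [sq, hpi]
  | succ m ih =>
    have h := hermiteFun_add_two_apply_zero_sq (2 * m)
    rw [ih] at h
    have hGamma_half : Real.Gamma ((m : ℝ) + 1 + 1 / 2) =
        (m + 1 / 2) * Real.Gamma ((m : ℝ) + 1 / 2) := by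
      rw [← Real.Gamma_add_one (by positivity)]
      ring_nf
    have hGamma : Real.Gamma ((m : ℝ) + 1 + 1) = (m + 1) * Real.Gamma ((m : ℝ) + 1) :=
      Real.Gamma_add_one (by positivity)
    have hGamma_ne : Real.Gamma ((m : ℝ) + 1) ≠ 0 := (Real.Gamma_pos_of_pos (by positivity)).ne'
    rw [show 2 * (m + 1) = 2 * m + 2 by ring]
    push_cast at h ⊢
    rw [hGamma_half, hGamma]
    field_simp at h ⊢
    linarith

theorem two_mul_omegaConst_div_pi (n : ℕ) :
    2 * (omegaConst n / Real.pi) =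
      2 * (n + 1) * hermiteFun n 0 ^ 2 + (2 * n + 3) * hermiteFun (n + 1) 0 ^ 2 := by
  rcases Nat.even_or_odd' n with ⟨m, rfl | rfl⟩
  · have hGamma_ne : Real.Gamma ((m : ℝ) + 1) ≠ 0 := (Real.Gamma_pos_of_pos (by positivity)).ne'
    rw [omegaConst, if_neg (by simp), hermiteFun_odd_apply_zero, hermiteFun_even_apply_zero_sq]
    push_cast
    rw [show (2 * (m : ℝ) + 1) / 2 = m + 1 / 2 by ring, show 2 * (m : ℝ) / 2 + 1 = m + 1 by ring]
    field_simp
    ring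
  · have hGamma : Real.Gamma ((m : ℝ) + 1 + 1) = (m + 1) * Real.Gamma ((m : ℝ) + 1) :=
      Real.Gamma_add_one (by positivity)
    have hGamma_ne : Real.Gamma ((m : ℝ) + 1) ≠ 0 := (Real.Gamma_pos_of_pos (by positivity)).ne'
    rw [omegaConst, if_pos ⟨m, rfl⟩, hermiteFun_odd_apply_zero,
      show 2 * m + 1 + 1 = 2 * (m + 1) by ring, hermiteFun_even_apply_zero_sq]
    push_cast
    rw [show (2 * (m : ℝ) + 1) / 2 + 1 = m + 1 + 1 / 2 by ring,
      show (2 * (m : ℝ) + 1 + 1) / 2 = m + 1 by ring, hGamma]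
    field_simp
    ring

theorem sum_hermiteFun_sq_le (n : ℕ) (x : ℝ) :
    ∑ k ∈ Finset.range (n + 1), hermiteFun k x ^ 2 ≤ omegaConst n / Real.pi := by
  have hle := two_mul_sum_hermiteFun_sq_add_sq_le n x
  rw [sum_hermiteFun_apply_zero_sq] at hle
  linarith [two_mul_omegaConst_div_pi n, sq_nonneg (hermiteFun (n + 1) x)]

end HermiteKernel

/-! ### The form domain of the harmonic oscillator -/

/-- The form domain of the harmonic oscillator: `u` is locally absolutely continuous with derivative
`v`, and `u`, `v` and `x ↦ x * u x` are square integrable. -/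
structure HarmonicFormDomain (u v : ℝ → ℝ) : Prop where
  prim : IsLocalPrimitive u v
  memLp : MemLp u 2 volume
  memLp_deriv : MemLp v 2 volume
  memLp_id_mul : MemLp (fun x => x * u x) 2 volume

theorem harmonicFormDomain_hermiteFun (k : ℕ) :
    HarmonicFormDomain (hermiteFun k) (deriv (hermiteFun k)) := by
  have hid : MemLp (fun x => x * hermiteFun k x) 2 volume := by
    simpa only [pow_one] using memLp_pow_mul_hermiteFun 1 k
  refine ⟨.of_hasDerivAt (fun x => (differentiable_hermiteFun k x).hasDerivAt)
    (continuous_deriv_hermiteFun k), memLp_hermiteFun k, ?_, hid⟩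
  rw [funext (deriv_hermiteFun k)]
  exact hid.sub ((memLp_hermiteFun (k + 1)).const_mul _)

namespace HarmonicFormDomain

variable {u v u₁ v₁ : ℝ → ℝ}

theorem integral_deriv_mul (h : HarmonicFormDomain u v) (h₁ : HarmonicFormDomain u₁ v₁) :
    ∫ x, v x * u₁ x = -∫ x, u x * v₁ x := by
  have hleft := h.memLp_deriv.integrable_mul h₁.memLp
  have hright := h.memLp.integrable_mul h₁.memLp_deriv
  have hzero := (h.prim.mul h₁.prim).integral_eq_zero (hleft.add hright)
    (h.memLp.integrable_mul h₁.memLp)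
  exact eq_neg_of_add_eq_zero_left ((integral_add hleft hright).symm.trans hzero)

theorem integral_lowering_mul_hermiteFun (h : HarmonicFormDomain u v) (k : ℕ) :
    ∫ x, (v x + x * u x) * hermiteFun k x =
      √(2 * (k + 1 : ℝ)) * ∫ x, u x * hermiteFun (k + 1) x := by
  have hparts := h.integral_deriv_mul (harmonicFormDomain_hermiteFun k)
  have hderiv : Integrable (fun x => v x * hermiteFun k x) volume :=
    h.memLp_deriv.integrable_mul (memLp_hermiteFun k)
  have hid : Integrable (fun x => x * u x * hermiteFun k x) volume :=
    h.memLp_id_mul.integrable_mul (memLp_hermiteFun k)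
  have hsucc : Integrable (fun x => u x * hermiteFun (k + 1) x) volume :=
    h.memLp.integrable_mul (memLp_hermiteFun (k + 1))
  have hexpand (x : ℝ) : u x * deriv (hermiteFun k) x = x * u x * hermiteFun k x -
      √(2 * (k + 1 : ℝ)) * (u x * hermiteFun (k + 1) x) := by
    rw [deriv_hermiteFun]
    ring
  simp only [hexpand] at hparts
  rw [integral_sub hid (hsucc.const_mul _), integral_const_mul] at hparts
  simp only [add_mul]
  rw [integral_add hderiv hid]
  linarith

end HarmonicFormDomain

section HermiteOrthonormality

theorem integral_hermiteFun_succ_mul_succ (k j : ℕ) :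
    √(2 * (j + 1 : ℝ)) * ∫ x, hermiteFun (k + 1) x * hermiteFun (j + 1) x =
      √(2 * (k + 1 : ℝ)) * ∫ x, hermiteFun k x * hermiteFun j x := by
  rw [← (harmonicFormDomain_hermiteFun (k + 1)).integral_lowering_mul_hermiteFun j,
    ← integral_const_mul]
  congr 1 with x
  rw [deriv_hermiteFun_succ]
  ring

theorem integral_hermiteFun_zero_mul_succ (j : ℕ) :
    ∫ x, hermiteFun 0 x * hermiteFun (j + 1) x = 0 := by
  have h := (harmonicFormDomain_hermiteFun 0).integral_lowering_mul_hermiteFun j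
  have hlowering (x : ℝ) : deriv (hermiteFun 0) x + x * hermiteFun 0 x = 0 := by
    rw [deriv_hermiteFun_zero]
    ring
  simp only [hlowering, zero_mul, integral_zero] at h
  exact (mul_eq_zero.1 h.symm).resolve_left (by positivity)

theorem integral_hermiteFun_zero_sq : ∫ x, hermiteFun 0 x * hermiteFun 0 x = 1 := by
  have hsq (x : ℝ) : hermiteFun 0 x * hermiteFun 0 x = (√Real.pi)⁻¹ * Real.exp (-1 * x ^ 2) := by
    have hexp : Real.exp (-1 * x ^ 2) =
        Real.exp (-(1 / 2) * x ^ 2) * Real.exp (-(1 / 2) * x ^ 2) := by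
      rw [← Real.exp_add]
      ring_nf
    rw [hermiteFun_zero, hexp, ← Real.mul_self_sqrt (Real.sqrt_nonneg Real.pi), mul_inv,
      Real.mul_self_sqrt (Real.sqrt_nonneg Real.pi)]
    ring
  simp only [hsq]
  rw [integral_const_mul, integral_gaussian, div_one]
  exact inv_mul_cancel₀ (Real.sqrt_ne_zero'.2 Real.pi_pos)

theorem integral_hermiteFun_mul_hermiteFun (k j : ℕ) :
    ∫ x, hermiteFun k x * hermiteFun j x = if k = j then 1 else 0 := by
  induction k generalizing j with
  | zero =>
    cases j with
    | zero => exact integral_hermiteFun_zero_sq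
    | succ j => simpa using integral_hermiteFun_zero_mul_succ j
  | succ k ih =>
    cases j with
    | zero => simpa [mul_comm] using integral_hermiteFun_zero_mul_succ k
    | succ j =>
      have h := integral_hermiteFun_succ_mul_succ k j
      have hsqrt : √(2 * (j + 1 : ℝ)) ≠ 0 := by positivity
      rw [ih j] at h
      by_cases hkj : k = j
      · subst hkj
        simpa only [if_true] using mul_left_cancel₀ hsqrt h
      · simp only [hkj, if_false, mul_zero, mul_eq_zero, hsqrt, false_or] at h
        simpa [hkj] using h

end HermiteOrthonormality

section HermiteCompleteness

open scoped FourierTransform SchwartzMap ContDiff in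
theorem ae_eq_zero_of_fourier_eq_zero {V E : Type*} [NormedAddCommGroup V]
    [InnerProductSpace ℝ V] [FiniteDimensional ℝ V] [MeasurableSpace V] [BorelSpace V]
    [NormedAddCommGroup E] [NormedSpace ℂ E] [CompleteSpace E] {F : V → E}
    (hF : Integrable F volume) (h : ∀ ξ, 𝓕 F ξ = 0) : F =ᵐ[volume] 0 := by
  refine ae_eq_zero_of_integral_contDiff_smul_eq_zero hF.locallyIntegrable
    fun φ hφ_smooth hφ_compact => ?_
  have hcompact : HasCompactSupport (Complex.ofRealCLM ∘ φ) := hφ_compact.comp_left rfl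
  have hsmooth : ContDiff ℝ ∞ (Complex.ofRealCLM ∘ φ) := by fun_prop
  set ψ : 𝓢(V, ℂ) := 𝓕⁻ (hcompact.toSchwartzMap hsmooth) with hψ
  have hφ (x : V) : 𝓕 (ψ : V → ℂ) x = (φ x : ℂ) := by
    rw [← SchwartzMap.fourier_coe, hψ, FourierTransform.fourier_fourierInv_eq]
    rfl
  calc ∫ x, φ x • F x = ∫ x, 𝓕 (ψ : V → ℂ) x • F x := by simp only [hφ, Complex.coe_smul]
    _ = ∫ ξ, ψ ξ • 𝓕 F ξ := by
      have hflip := VectorFourier.integral_fourierIntegral_smul_eq_flip (L := innerₗ V)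
        Real.continuous_fourierChar continuous_inner (ψ.integrable (μ := volume))
        hF
      rwa [flip_innerₗ] at hflip
    _ = 0 := by simp only [h, smul_zero, integral_zero]

theorem integral_mul_cexp_eq_zero_of_moments {F : ℝ → ℝ}
    (hexp : ∀ t : ℝ, Integrable (fun x => F x * Real.exp |t * x|) volume)
    (hmom : ∀ n : ℕ, ∫ x, x ^ n * F x = 0) (t : ℝ) :
    ∫ x : ℝ, Complex.exp (t * x * Complex.I) * (F x : ℂ) = 0 := by
  have hF : Integrable F volume := by simpa using hexp 0
  have hseries (z : ℂ) : HasSum (fun n : ℕ => z ^ n / (n.factorial : ℂ)) (Complex.exp z) := by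
    rw [Complex.exp_eq_exp_ℂ]
    exact NormedSpace.expSeries_div_hasSum_exp z
  have hbound (x : ℝ) :
      HasSum (fun n : ℕ => |t * x| ^ n / n.factorial * |F x|) (Real.exp |t * x| * |F x|) := by
    rw [Real.exp_eq_exp_ℝ]
    exact (NormedSpace.expSeries_div_hasSum_exp |t * x|).mul_right _
  have hsum := hasSum_integral_of_dominated_convergence (μ := volume)
    (F := fun (n : ℕ) (x : ℝ) => ((t * x * Complex.I) ^ n / (n.factorial : ℂ)) * (F x : ℂ))
    (f := fun x : ℝ => Complex.exp (t * x * Complex.I) * (F x : ℂ))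
    (fun n x => |t * x| ^ n / n.factorial * |F x|)
    (fun n => (by fun_prop : Continuous fun x : ℝ =>
      ((t * x * Complex.I) ^ n / n.factorial : ℂ)).aestronglyMeasurable.mul
        hF.ofReal.aestronglyMeasurable)
    (fun n => .of_forall fun x => by simp [abs_mul])
    (.of_forall fun x => (hbound x).summable)
    ((hexp t).abs.congr (.of_forall fun x => by
      simp only [(hbound x).tsum_eq, abs_mul (F x), Real.abs_exp, mul_comm |F x|]))
    (.of_forall fun x => (hseries _).mul_right _)
  refine hsum.unique ?_
  convert! hasSum_zero with n
  have hterm (x : ℝ) : (t * x * Complex.I) ^ n / (n.factorial : ℂ) * (F x : ℂ) =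
      (t * Complex.I) ^ n / (n.factorial : ℂ) * ((x ^ n * F x : ℝ) : ℂ) := by
    push_cast
    ring
  simp only [hterm]
  rw [integral_const_mul, integral_complex_ofReal, hmom n, Complex.ofReal_zero, mul_zero]

theorem ae_eq_zero_of_moments_eq_zero {F : ℝ → ℝ}
    (hexp : ∀ t : ℝ, Integrable (fun x => F x * Real.exp |t * x|) volume)
    (hmom : ∀ n : ℕ, ∫ x, x ^ n * F x = 0) : F =ᵐ[volume] 0 := by
  have hF : Integrable F volume := by simpa using hexp 0
  have hfourier : (fun x => (F x : ℂ)) =ᵐ[volume] 0 := by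
    refine ae_eq_zero_of_fourier_eq_zero hF.ofReal fun ξ => ?_
    rw [Real.fourier_eq']
    convert! integral_mul_cexp_eq_zero_of_moments hexp hmom (-2 * Real.pi * ξ) using 3 with x
    simp only [RCLike.inner_apply, conj_trivial]
    push_cast
    ring_nf
  filter_upwards [hfourier] with x hx
  simpa using hx

theorem integral_mul_pow_mul_hermiteFun_eq_zero {f : ℝ → ℝ} (hf : MemLp f 2 volume)
    (h : ∀ k, ∫ x, f x * hermiteFun k x = 0) (m k : ℕ) :
    ∫ x, f x * (x ^ m * hermiteFun k x) = 0 := by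
  have hint (m k : ℕ) : Integrable (fun x => f x * (x ^ m * hermiteFun k x)) volume :=
    hf.integrable_mul (memLp_pow_mul_hermiteFun m k)
  induction m generalizing k with
  | zero => simpa using h k
  | succ m ih =>
    cases k with
    | zero =>
      have hrec (x : ℝ) : f x * (x ^ (m + 1) * hermiteFun 0 x) =
          √2 / 2 * (f x * (x ^ m * hermiteFun 1 x)) := by
        linear_combination (-f x * x ^ m / 2) * hermiteFun_one x
      simp only [hrec]
      rw [integral_const_mul, ih, mul_zero]
    | succ k =>
      have hrec (x : ℝ) : f x * (x ^ (m + 1) * hermiteFun (k + 1) x) =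
          √(2 * (k + 2 : ℝ)) / 2 * (f x * (x ^ m * hermiteFun (k + 2) x)) +
          √(2 * (k + 1 : ℝ)) / 2 * (f x * (x ^ m * hermiteFun k x)) := by
        linear_combination (-f x * x ^ m / 2) * hermiteFun_recurrence k x
      simp only [hrec]
      rw [integral_add ((hint m _).const_mul _) ((hint m _).const_mul _), integral_const_mul,
        integral_const_mul, ih, ih, mul_zero, mul_zero, add_zero]

theorem memLp_hermiteFun_zero_mul_exp (t : ℝ) :
    MemLp (fun x => hermiteFun 0 x * Real.exp |t * x|) 2 volume := by
  have hcont : Continuous fun x => hermiteFun 0 x * Real.exp |t * x| := by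
    have := continuous_hermiteFun 0
    fun_prop
  refine (memLp_two_iff_integrable_sq hcont.aestronglyMeasurable).2 ?_
  refine Integrable.mono' ((integrable_exp_neg_mul_sq (b := 1 / 2) (by norm_num)).const_mul
    ((√(√Real.pi))⁻¹ ^ 2 * Real.exp (2 * t ^ 2))) (hcont.pow 2).aestronglyMeasurable
    (.of_forall fun x => ?_)
  have hyoung : |t * x| ≤ t ^ 2 + x ^ 2 / 4 := by
    rw [abs_le]
    constructor <;> nlinarith [sq_nonneg (t + x / 2), sq_nonneg (t - x / 2)]
  rw [Real.norm_of_nonneg (sq_nonneg _), hermiteFun_zero, mul_pow, mul_pow, mul_assoc, mul_assoc,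
    ← Real.exp_add, ← Real.exp_nat_mul, ← Real.exp_nat_mul, ← Real.exp_add]
  refine mul_le_mul_of_nonneg_left (Real.exp_le_exp.2 ?_) (sq_nonneg _)
  push_cast
  linarith

theorem ae_eq_zero_of_integral_mul_hermiteFun_eq_zero {f : ℝ → ℝ} (hf : MemLp f 2 volume)
    (h : ∀ k, ∫ x, f x * hermiteFun k x = 0) : f =ᵐ[volume] 0 := by
  have hzero : (fun x => f x * hermiteFun 0 x) =ᵐ[volume] 0 := by
    refine ae_eq_zero_of_moments_eq_zero (fun t => ?_) fun m => ?_
    · exact (hf.integrable_mul (memLp_hermiteFun_zero_mul_exp t)).congr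
        (.of_forall fun x => (mul_assoc _ _ _).symm)
    · simpa only [mul_left_comm] using integral_mul_pow_mul_hermiteFun_eq_zero hf h m 0
  filter_upwards [hzero] with x hx
  refine (mul_eq_zero.1 hx).resolve_right ?_
  rw [hermiteFun_zero]
  positivity

end HermiteCompleteness

section Parseval

theorem inner_toLp_toLp {α : Type*} [MeasurableSpace α] {ν : Measure α} {f g : α → ℝ}
    (hf : MemLp f 2 ν) (hg : MemLp g 2 ν) :
    inner ℝ (hf.toLp f) (hg.toLp g) = ∫ x, f x * g x ∂ν := by
  rw [L2.inner_def]
  refine integral_congr_ae ?_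
  filter_upwards [hf.coeFn_toLp, hg.coeFn_toLp] with x hfx hgx
  rw [hfx, hgx, real_inner_eq_re_inner]
  simp [mul_comm]

theorem hasSum_sq_integral_mul {α ι : Type*} [MeasurableSpace α] {ν : Measure α} [DecidableEq ι]
    {e : ι → α → ℝ} (he : ∀ i, MemLp (e i) 2 ν)
    (horth : ∀ i j, ∫ x, e i x * e j x ∂ν = if i = j then 1 else 0)
    (hcomplete : ∀ f : α → ℝ, MemLp f 2 ν → (∀ i, ∫ x, f x * e i x ∂ν = 0) → f =ᵐ[ν] 0)
    {f : α → ℝ} (hf : MemLp f 2 ν) :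
    HasSum (fun i => (∫ x, f x * e i x ∂ν) ^ 2) (∫ x, f x ^ 2 ∂ν) := by
  have horthonormal : Orthonormal ℝ fun i => (he i).toLp (e i) :=
    orthonormal_iff_ite.2 fun i j => by rw [inner_toLp_toLp, horth]
  have hbot : (Submodule.span ℝ (Set.range fun i => (he i).toLp (e i)))ᗮ = ⊥ := by
    refine (Submodule.eq_bot_iff _).2 fun g hg => (Lp.eq_zero_iff_ae_eq_zero).2 ?_
    refine hcomplete g (Lp.memLp g) fun i => ?_
    rw [← inner_toLp_toLp (Lp.memLp g) (he i), Lp.toLp_coeFn, real_inner_comm]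
    exact (Submodule.mem_orthogonal _ _).1 hg _ (Submodule.subset_span ⟨i, rfl⟩)
  have hsum := (HilbertBasis.mkOfOrthogonalEqBot horthonormal hbot).hasSum_inner_mul_inner
    (hf.toLp f) (hf.toLp f)
  simpa only [HilbertBasis.coe_mkOfOrthogonalEqBot, real_inner_comm (hf.toLp f),
    inner_toLp_toLp, ← pow_two] using hsum

end Parseval

theorem hasSum_sq_integral_mul_hermiteFun {f : ℝ → ℝ} (hf : MemLp f 2 volume) :
    HasSum (fun k => (∫ x, f x * hermiteFun k x) ^ 2) (∫ x, f x ^ 2) :=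
  hasSum_sq_integral_mul memLp_hermiteFun integral_hermiteFun_mul_hermiteFun
    (fun _ => ae_eq_zero_of_integral_mul_hermiteFun_eq_zero) hf

namespace HarmonicFormDomain

variable {u v u₁ v₁ : ℝ → ℝ}

theorem add (h : HarmonicFormDomain u v) (h₁ : HarmonicFormDomain u₁ v₁) :
    HarmonicFormDomain (fun x => u x + u₁ x) (fun x => v x + v₁ x) where
  prim := h.prim.add h₁.prim
  memLp := h.memLp.add h₁.memLp
  memLp_deriv := h.memLp_deriv.add h₁.memLp_deriv
  memLp_id_mul := (h.memLp_id_mul.add h₁.memLp_id_mul).ae_eq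
    (.of_forall fun x => (mul_add x (u x) (u₁ x)).symm)

theorem const_mul (h : HarmonicFormDomain u v) (c : ℝ) :
    HarmonicFormDomain (fun x => c * u x) (fun x => c * v x) where
  prim := h.prim.const_mul c
  memLp := h.memLp.const_mul c
  memLp_deriv := h.memLp_deriv.const_mul c
  memLp_id_mul := (h.memLp_id_mul.const_mul c).ae_eq
    (.of_forall fun x => mul_left_comm c x (u x))

theorem zero : HarmonicFormDomain (fun _ => 0) (fun _ => 0) := by
  simpa using (harmonicFormDomain_hermiteFun 0).const_mul 0

theorem sum_mul {ι : Type*} (s : Finset ι) (c : ι → ℝ) {u v : ι → ℝ → ℝ}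
    (h : ∀ i, HarmonicFormDomain (u i) (v i)) :
    HarmonicFormDomain (fun x => ∑ i ∈ s, c i * u i x) (fun x => ∑ i ∈ s, c i * v i x) := by
  classical
  induction s using Finset.induction_on with
  | empty => simpa using zero
  | insert i s hi ih => simpa [Finset.sum_insert hi] using ((h i).const_mul (c i)).add ih

theorem continuous (h : HarmonicFormDomain u v) : Continuous u := h.prim.continuous

theorem exists_bound (h : HarmonicFormDomain u v) : ∃ C, ∀ x, |u x| ≤ C := by
  obtain ⟨C, hC⟩ := (h.prim.mul h.prim).exists_bound
    ((h.memLp_deriv.integrable_mul h.memLp).add (h.memLp.integrable_mul h.memLp_deriv))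
  refine ⟨√C, fun x => Real.le_sqrt_of_sq_le ?_⟩
  rw [pow_two, ← abs_mul]
  exact hC x

theorem integrable_mul_mul {q : ℝ → ℝ} (h : HarmonicFormDomain u v)
    (h₁ : HarmonicFormDomain u₁ v₁) (hq : Integrable q volume) :
    Integrable (fun x => q x * (u x * u₁ x)) volume := by
  obtain ⟨C, hC⟩ := h.exists_bound
  obtain ⟨D, hD⟩ := h₁.exists_bound
  refine hq.mul_bdd (c := C * D) (h.continuous.mul h₁.continuous).aestronglyMeasurable
    (.of_forall fun x => ?_)
  rw [norm_mul]
  exact mul_le_mul (hC x) (hD x) (abs_nonneg _) ((abs_nonneg _).trans (hC x))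

theorem two_mul_integral_deriv_mul_id_mul (h : HarmonicFormDomain u v) :
    2 * ∫ x, v x * (x * u x) = -∫ x, u x ^ 2 := by
  have hsq := h.memLp.integrable_sq
  have hcross : Integrable (fun x => v x * (x * u x)) volume :=
    h.memLp_deriv.integrable_mul h.memLp_id_mul
  have hprim := (IsLocalPrimitive.of_hasDerivAt hasDerivAt_id' continuous_const).mul
    (h.prim.mul h.prim)
  have hderiv : (fun x => 1 * (u x * u x) + x * (v x * u x + u x * v x)) =
      fun x => u x ^ 2 + 2 * (v x * (x * u x)) := by
    ext x
    ring
  rw [hderiv] at hprim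
  have hzero := hprim.integral_eq_zero (hsq.add (hcross.const_mul 2))
    ((h.memLp_id_mul.integrable_mul h.memLp).congr (.of_forall fun x => mul_assoc _ _ _))
  rw [integral_add hsq (hcross.const_mul 2), integral_const_mul] at hzero
  linarith

theorem integral_lowering_sq (h : HarmonicFormDomain u v) :
    ∫ x, (v x + x * u x) ^ 2 = (∫ x, v x ^ 2) + (∫ x, (x * u x) ^ 2) - ∫ x, u x ^ 2 := by
  have hderiv := h.memLp_deriv.integrable_sq
  have hid := h.memLp_id_mul.integrable_sq
  have hsum : Integrable (fun x => v x ^ 2 + (x * u x) ^ 2) volume := hderiv.add hid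
  have hcross : Integrable (fun x => v x * (x * u x)) volume :=
    h.memLp_deriv.integrable_mul h.memLp_id_mul
  have hexpand (x : ℝ) : (v x + x * u x) ^ 2 =
      (v x ^ 2 + (x * u x) ^ 2) + 2 * (v x * (x * u x)) := by
    ring
  simp only [hexpand]
  rw [integral_add hsum (hcross.const_mul 2), integral_add hderiv hid,
    integral_const_mul, h.two_mul_integral_deriv_mul_id_mul, sub_eq_add_neg]

theorem hasSum_energy (h : HarmonicFormDomain u v) :
    HasSum (fun k : ℕ => (2 * k + 1) * (∫ x, u x * hermiteFun k x) ^ 2)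
      ((∫ x, v x ^ 2) + ∫ x, (x * u x) ^ 2) := by
  have hlowering := hasSum_sq_integral_mul_hermiteFun (h.memLp_deriv.add h.memLp_id_mul)
  simp only [Pi.add_apply, h.integral_lowering_sq, h.integral_lowering_mul_hermiteFun] at hlowering
  have hshift : HasSum (fun k : ℕ => 2 * k * (∫ x, u x * hermiteFun k x) ^ 2)
      ((∫ x, v x ^ 2) + (∫ x, (x * u x) ^ 2) - ∫ x, u x ^ 2) := by
    rw [← hasSum_nat_add_iff' 1, Finset.sum_range_one, Nat.cast_zero, mul_zero, zero_mul, sub_zero]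
    convert! hlowering using 2 with k
    rw [mul_pow, Real.sq_sqrt (by positivity)]
    push_cast
    ring
  simpa [add_mul] using hshift.add (hasSum_sq_integral_mul_hermiteFun h.memLp)

theorem energy_ge (h : HarmonicFormDomain u v) (N : ℕ) :
    (2 * N + 1) * ((∫ x, u x ^ 2) - ∑ k ∈ Finset.range N, (∫ x, u x * hermiteFun k x) ^ 2) ≤
      (∫ x, v x ^ 2) + ∫ x, (x * u x) ^ 2 := by
  have hmass := ((hasSum_nat_add_iff' N).2 (hasSum_sq_integral_mul_hermiteFun h.memLp)).mul_left
    (2 * N + 1 : ℝ)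
  have henergy := (hasSum_nat_add_iff' N).2 h.hasSum_energy
  refine (hasSum_le (fun k => ?_) hmass henergy).trans
    (sub_le_self _ (Finset.sum_nonneg fun k _ => by positivity))
  gcongr
  exact_mod_cast Nat.le_add_left N k

end HarmonicFormDomain

theorem hermiteFun_energy (k : ℕ) :
    (∫ x, deriv (hermiteFun k) x ^ 2) + (∫ x, (x * hermiteFun k x) ^ 2) = 2 * k + 1 := by
  refine (harmonicFormDomain_hermiteFun k).hasSum_energy.unique ?_
  simp only [integral_hermiteFun_mul_hermiteFun, ite_pow, one_pow]
  convert! hasSum_ite_eq k (2 * k + 1 : ℝ) using 2 with j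
  by_cases hkj : k = j <;> simp [hkj, eq_comm]

/-! ### Simplicity of the eigenvalues -/

theorem intervalIntegral_le_of_le_of_nonneg {f g : ℝ → ℝ} {a b c d : ℝ}
    (hf : LocallyIntegrable f volume) (hg : LocallyIntegrable g volume) (hca : c ≤ a) (hab : a ≤ b)
    (hbd : b ≤ d) (hfg : ∀ᵐ x, x ∈ Set.Icc a b → f x ≤ g x) (hg₀ : ∀ᵐ x, 0 ≤ g x) :
    ∫ x in a..b, f x ≤ ∫ x in c..d, g x :=
  (intervalIntegral.integral_mono_ae_restrict hab (intervalIntegrable_of_locallyIntegrable hf a b)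
    (intervalIntegrable_of_locallyIntegrable hg a b)
    ((ae_restrict_iff' measurableSet_Icc).2 hfg)).trans
  (intervalIntegral.integral_mono_interval hca hab hbd (ae_restrict_of_ae hg₀)
    (intervalIntegrable_of_locallyIntegrable hg c d))

namespace IsSchrodingerL2Solution

variable {V u u₁ : ℝ → ℝ} {μ : ℝ}

theorem prim_deriv (h : IsSchrodingerL2Solution V μ u) :
    IsLocalPrimitive (deriv u) (fun x => (V x - μ) * u x) :=
  (IsLocalPrimitive.of_absolutelyContinuous h.absolutelyContinuous_deriv).congr
    (h.equation.mono fun x hx => by linarith [hx.2])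

theorem prim (h : IsSchrodingerL2Solution V μ u) : IsLocalPrimitive u (deriv u) :=
  .of_hasDerivAt (fun x => (h.differentiable x).hasDerivAt) h.prim_deriv.continuous

section Energy

theorem half_sq_mul_energy_le {c d a b W : ℝ} (hc₀ : 0 ≤ c) (hc₁ : c ≤ 1) (hd : d ^ 2 ≤ 1)
    (hW : 0 ≤ W) (μ : ℝ) :
    c ^ 2 / 2 * (b ^ 2 + W * a ^ 2) ≤
      (d * c + c * d) * (a * b) + c * c * (b * b + a * ((W - μ) * a)) + (|μ| + 2) * a ^ 2 := by
  have hcsq : c ^ 2 ≤ 1 := pow_le_one₀ hc₀ hc₁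
  have hμ : c ^ 2 * μ ≤ |μ| :=
    (mul_le_mul_of_nonneg_left (le_abs_self μ) (sq_nonneg c)).trans
      (mul_le_of_le_one_left (abs_nonneg μ) hcsq)
  have hμa := mul_le_mul_of_nonneg_right hμ (sq_nonneg a)
  have hda := mul_le_mul_of_nonneg_right hd (sq_nonneg a)
  have hWa : 0 ≤ c ^ 2 * (W * a ^ 2) := by positivity
  nlinarith [sq_nonneg (c * b + 2 * d * a)]

theorem locallyIntegrable_energy (h : IsSchrodingerL2Solution V μ u) :
    LocallyIntegrable (fun x => deriv u x ^ 2 + V x * u x ^ 2) volume := by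
  have hcont : Continuous fun x => μ * u x ^ 2 := (h.prim.continuous.pow 2).const_mul μ
  refine ((h.prim.mul h.prim_deriv).locallyIntegrable.add hcont.locallyIntegrable).congr
    (.of_forall fun x => ?_)
  simp only [Pi.add_apply]
  ring

-- Caccioppoli's estimate: integrate `(χ² u u')'` over `[a, b]`.
theorem integral_sq_mul_energy_le (hV : ∀ᵐ x, 0 ≤ V x) (h : IsSchrodingerL2Solution V μ u)
    {χ χ' : ℝ → ℝ} (hχ : IsLocalPrimitive χ χ') {a b : ℝ} (hab : a ≤ b) (hχa : χ a = 0)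
    (hχb : χ b = 0) (hχ_mem : ∀ x ∈ Set.Icc a b, χ x ∈ Set.Icc 0 1)
    (hχ'_sq : ∀ x ∈ Set.Icc a b, χ' x ^ 2 ≤ 1) :
    ∫ x in a..b, χ x ^ 2 / 2 * (deriv u x ^ 2 + V x * u x ^ 2) ≤ (|μ| + 2) * ∫ x, u x ^ 2 := by
  have hprim := (hχ.mul hχ).mul (h.prim.mul h.prim_deriv)
  have husq : IntervalIntegrable (fun x => (|μ| + 2) * u x ^ 2) volume a b :=
    ((h.prim.continuous.pow 2).const_mul (|μ| + 2)).intervalIntegrable a b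
  have hχ_energy := intervalIntegrable_of_locallyIntegrable
    h.locallyIntegrable_energy a b |>.continuousOn_mul
    (((hχ.continuous.pow 2).div_const 2).continuousOn)
  calc ∫ x in a..b, χ x ^ 2 / 2 * (deriv u x ^ 2 + V x * u x ^ 2)
      ≤ ∫ x in a..b, (((χ' x * χ x + χ x * χ' x) * (u x * deriv u x) +
          χ x * χ x * (deriv u x * deriv u x + u x * ((V x - μ) * u x))) +
          (|μ| + 2) * u x ^ 2) := by
        refine intervalIntegral.integral_mono_ae_restrict hab hχ_energy
          ((hprim.intervalIntegrable a b).add husq) ?_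
        filter_upwards [ae_restrict_of_ae hV, ae_restrict_mem measurableSet_Icc] with x hVx hx
        exact half_sq_mul_energy_le (hχ_mem x hx).1 (hχ_mem x hx).2 (hχ'_sq x hx) hVx μ
    _ = (|μ| + 2) * ∫ x in a..b, u x ^ 2 := by
        rw [intervalIntegral.integral_add (hprim.intervalIntegrable a b) husq,
          ← hprim.sub_eq_integral, intervalIntegral.integral_const_mul, hχa, hχb]
        ring
    _ ≤ (|μ| + 2) * ∫ x, u x ^ 2 := by
        rw [intervalIntegral.integral_of_le hab]
        exact mul_le_mul_of_nonneg_left (setIntegral_le_integral h.memLp.integrable_sq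
          (.of_forall fun x => sq_nonneg _)) (by positivity)

theorem integral_energy_le (hV : ∀ᵐ x, 0 ≤ V x) (h : IsSchrodingerL2Solution V μ u) {r : ℝ}
    (hr : 1 ≤ r) :
    ∫ x in (-r)..r, (deriv u x ^ 2 + V x * u x ^ 2) ≤ 4 * ((|μ| + 2) * ∫ x, u x ^ 2) := by
  have hr_pos : 0 < r := one_pos.trans_le hr
  set χ : ℝ → ℝ := fun x => 1 - (x / (2 * r)) ^ 2 with hχ
  have hprim : IsLocalPrimitive χ fun x => -(x / (2 * r ^ 2)) := by
    refine .of_hasDerivAt (fun x => ?_) (by fun_prop)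
    convert! (((hasDerivAt_id' x).div_const (2 * r)).fun_pow 2).const_sub 1 using 1
    norm_num only [Nat.add_one_sub_one, pow_one]
    field_simp
  have hratio : ∀ x ∈ Set.Icc (-(2 * r)) (2 * r), (x / (2 * r)) ^ 2 ≤ 1 := fun x hx => by
    rw [div_pow]
    exact div_le_one_of_le₀ (sq_le_sq' hx.1 hx.2) (sq_nonneg _)
  have hcutoff := h.integral_sq_mul_energy_le hV hprim (a := -(2 * r)) (b := 2 * r) (by linarith)
    (by simp only [hχ]; field_simp; norm_num) (by simp only [hχ]; field_simp; norm_num)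
    (fun x hx => ⟨sub_nonneg.2 (hratio x hx), sub_le_self _ (sq_nonneg _)⟩) fun x hx => by
      have hsplit : (-(x / (2 * r ^ 2))) ^ 2 = (x / (2 * r)) ^ 2 * (1 / r) ^ 2 := by field_simp
      rw [hsplit]
      exact mul_le_one₀ (hratio x hx) (sq_nonneg _)
        (pow_le_one₀ (by positivity) (div_le_one_of_le₀ hr hr_pos.le))
  have hχ_energy : LocallyIntegrable
      (fun x => χ x ^ 2 / 2 * (deriv u x ^ 2 + V x * u x ^ 2)) volume :=
    h.locallyIntegrable_energy.continuous_mul ((hprim.continuous.pow 2).div_const 2)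
  have hχ_energy_nonneg : ∀ᵐ x, 0 ≤ 4 * (χ x ^ 2 / 2 * (deriv u x ^ 2 + V x * u x ^ 2)) := by
    filter_upwards [hV] with x hVx
    positivity
  refine (intervalIntegral_le_of_le_of_nonneg h.locallyIntegrable_energy (hχ_energy.smul (4 : ℝ))
    (c := -(2 * r)) (d := 2 * r) (by linarith) (by linarith) (by linarith) ?_
    hχ_energy_nonneg).trans ?_
  · filter_upwards [hV] with x hVx hx
    have hχ_ge : 3 / 4 ≤ χ x := by
      have hsq : x ^ 2 / r ^ 2 ≤ 1 := div_le_one_of_le₀ (sq_le_sq' hx.1 hx.2) (sq_nonneg _)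
      simp only [hχ, div_pow, mul_pow]
      rw [mul_comm, ← div_div]
      linarith
    simp only [Pi.smul_apply, smul_eq_mul]
    rw [← mul_assoc]
    exact le_mul_of_one_le_left (by positivity) (by nlinarith)
  · exact (intervalIntegral.integral_const_mul 4 _).trans_le
      (mul_le_mul_of_nonneg_left hcutoff (by norm_num))

theorem integrable_energy (hV : ∀ᵐ x, 0 ≤ V x) (h : IsSchrodingerL2Solution V μ u) :
    Integrable (fun x => deriv u x ^ 2 + V x * u x ^ 2) volume := by
  refine integrable_of_intervalIntegral_norm_bounded (4 * ((|μ| + 2) * ∫ x, u x ^ 2))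
    (fun r : ℝ => (h.locallyIntegrable_energy.integrableOn_isCompact isCompact_Icc).mono_set
      Set.Ioc_subset_Icc_self) tendsto_neg_atTop_atBot tendsto_id ?_
  filter_upwards [eventually_ge_atTop (1 : ℝ)] with r hr
  refine le_of_eq_of_le (intervalIntegral.integral_congr_ae ?_) (h.integral_energy_le hV hr)
  filter_upwards [hV] with x hVx _
  exact Real.norm_of_nonneg (by positivity)

end Energy

theorem memLp_deriv (hV : ∀ᵐ x, 0 ≤ V x) (h : IsSchrodingerL2Solution V μ u) :
    MemLp (deriv u) 2 volume := by
  have hcont := h.prim_deriv.continuous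
  refine (memLp_two_iff_integrable_sq hcont.aestronglyMeasurable).2
    ((h.integrable_energy hV).mono' (hcont.pow 2).aestronglyMeasurable ?_)
  filter_upwards [hV] with x hVx
  rw [Real.norm_of_nonneg (by positivity)]
  exact le_add_of_nonneg_right (by positivity)

theorem eq_zero_of_initial (hV : LocallyIntegrable V volume) (h : IsSchrodingerL2Solution V μ u)
    {x₀ : ℝ} (hu₀ : u x₀ = 0) (hv₀ : deriv u x₀ = 0) : u = 0 :=
  funext fun x => h.prim.eq_zero_of_initial_eq_zero h.prim_deriv
    (hV.sub continuous_const.locallyIntegrable) (.of_forall fun _ => rfl) hu₀ hv₀ x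

theorem wronskian_eq_zero (hV : ∀ᵐ x, 0 ≤ V x) (h : IsSchrodingerL2Solution V μ u)
    (h₁ : IsSchrodingerL2Solution V μ u₁) (x : ℝ) : u x * deriv u₁ x - u₁ x * deriv u x = 0 := by
  have hint : Integrable (fun x => u x * deriv u₁ x - u₁ x * deriv u x) volume :=
    (h.memLp.integrable_mul (h₁.memLp_deriv hV)).sub (h₁.memLp.integrable_mul (h.memLp_deriv hV))
  have hconst := ((h.prim.mul h₁.prim_deriv).sub (h₁.prim.mul h.prim_deriv)).eq_of_ae_eq_zero
    (.of_forall fun x => by simp only [Pi.zero_apply]; ring)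
  have hconst_int : Integrable (fun _ : ℝ => u x * deriv u₁ x - u₁ x * deriv u x) volume :=
    hint.congr (.of_forall fun y => hconst y x)
  simpa [integrable_const_iff, isFiniteMeasure_iff] using hconst_int

theorem exists_smul_eq (hV : LocallyIntegrable V volume) (hV₀ : ∀ᵐ x, 0 ≤ V x)
    (h : IsSchrodingerL2Solution V μ u) (h₁ : IsSchrodingerL2Solution V μ u₁) (hu : u ≠ 0) :
    ∃ c : ℝ, c • u = u₁ := by
  have hpos : u 0 ^ 2 + deriv u 0 ^ 2 ≠ 0 := fun hzero =>
    hu (h.eq_zero_of_initial hV (x₀ := 0) (by nlinarith [sq_nonneg (deriv u 0)])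
      (by nlinarith [sq_nonneg (u 0)]))
  have hW := h.wronskian_eq_zero hV₀ h₁ 0
  -- `c` makes the Cauchy data of `c u` and `u₁` at `0` agree, as these are proportional.
  set c := (u 0 * u₁ 0 + deriv u 0 * deriv u₁ 0) / (u 0 ^ 2 + deriv u 0 ^ 2)
  have hc_mul : c * (u 0 ^ 2 + deriv u 0 ^ 2) = u 0 * u₁ 0 + deriv u 0 * deriv u₁ 0 :=
    div_mul_cancel₀ _ hpos
  have hdiff : IsSchrodingerL2Solution V μ (c • u - u₁) :=
    (schrodingerEigenspace V μ).sub_mem ((schrodingerEigenspace V μ).smul_mem c h) h₁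
  refine ⟨c, sub_eq_zero.1 (hdiff.eq_zero_of_initial hV (x₀ := 0) ?_ ?_)⟩
  · refine mul_left_cancel₀ hpos ?_
    simp only [Pi.sub_apply, Pi.smul_apply, smul_eq_mul]
    linear_combination u 0 * hc_mul + deriv u 0 * hW
  · rw [deriv_sub ((h.differentiable 0).const_smul c) (h₁.differentiable 0),
      deriv_const_smul c (h.differentiable 0)]
    refine mul_left_cancel₀ hpos ?_
    simp only [smul_eq_mul]
    linear_combination deriv u 0 * hc_mul - u 0 * hW

theorem rank_eigenspace_le_one (hV : LocallyIntegrable V volume) (hV₀ : ∀ᵐ x, 0 ≤ V x) (μ : ℝ) :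
    Module.rank ℝ (schrodingerEigenspace V μ) ≤ 1 := by
  rw [rank_submodule_le_one_iff']
  by_cases hex : ∃ u, IsSchrodingerL2Solution V μ u ∧ u ≠ 0
  · obtain ⟨u, hu, hu_ne⟩ := hex
    exact ⟨u, fun w hw => Submodule.mem_span_singleton.2 (hu.exists_smul_eq hV hV₀ hw hu_ne)⟩
  · push Not at hex
    exact ⟨0, fun w hw => by simp [hex w hw]⟩

end IsSchrodingerL2Solution

/-! ### Weak solutions and the du Bois-Reymond lemma -/

theorem exists_primitive_of_integral_eq_zero {E : Type*} [NormedAddCommGroup E] [NormedSpace ℝ E]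
    [CompleteSpace E] {η : ℝ → E} (hη : ContDiff ℝ ∞ η) (hη_supp : HasCompactSupport η)
    (hη_int : ∫ x, η x = 0) :
    ∃ φ : ℝ → E, ContDiff ℝ ∞ φ ∧ HasCompactSupport φ ∧ deriv φ = η := by
  obtain ⟨r, hr⟩ := hη_supp.isCompact.isBounded.subset_closedBall 0
  rw [Real.closedBall_eq_Icc, zero_sub, zero_add] at hr
  have hzero : ∀ x ∉ Set.Icc (-r) r, η x = 0 := fun x hx => image_eq_zero_of_notMem_tsupport
    fun hmem => hx (hr hmem)
  have hη_integrable := hη.continuous.integrable_of_hasCompactSupport (μ := volume) hη_supp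
  have hderiv : ∀ x, HasDerivAt (fun x => ∫ t in Set.Iic x, η t) (η x) x := by
    have hsplit : (fun x => ∫ t in Set.Iic x, η t) =
        fun x => (∫ t in Set.Iic 0, η t) + ∫ t in (0 : ℝ)..x, η t := by
      ext x
      rw [← intervalIntegral.integral_Iic_sub_Iic hη_integrable.integrableOn
        hη_integrable.integrableOn, add_sub_cancel]
    intro x
    rw [hsplit]
    exact (hη.continuous.integral_hasStrictDerivAt 0 x).hasDerivAt.const_add _
  have hderiv_eq : deriv (fun x => ∫ t in Set.Iic x, η t) = η := funext fun x => (hderiv x).deriv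
  refine ⟨fun x => ∫ t in Set.Iic x, η t, contDiff_infty_iff_deriv.2
    ⟨fun x => (hderiv x).differentiableAt, by rwa [hderiv_eq]⟩,
    .of_support_subset_isCompact (isCompact_Icc (a := -r) (b := r)) fun x hx => ?_, hderiv_eq⟩
  by_contra hmem
  refine hx ?_
  rcases lt_or_ge x (-r) with hlt | hge
  · exact setIntegral_eq_zero_of_forall_eq_zero fun t ht =>
      hzero t fun ht' => (ht'.1.trans ht).not_gt hlt
  · have hgt : r < x := lt_of_not_ge fun hle => hmem ⟨hge, hle⟩
    exact (setIntegral_eq_integral_of_forall_compl_eq_zero fun t ht =>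
      hzero t fun ht' => ht (ht'.2.trans hgt.le)).trans hη_int

theorem ae_eq_const_of_integral_deriv_mul_eq_zero {g : ℝ → ℝ} (hg : LocallyIntegrable g volume)
    (hg_zero : ∀ φ : ℝ → ℝ, ContDiff ℝ ∞ φ → HasCompactSupport φ → ∫ x, deriv φ x * g x = 0) :
    ∃ m : ℝ, ∀ᵐ x, g x = m := by
  set ρ : ℝ → ℝ := (default : ContDiffBump (0 : ℝ)).normed volume
  have hρ : ContDiff ℝ ∞ ρ := ContDiffBump.contDiff_normed _
  have hρ_supp : HasCompactSupport ρ := ContDiffBump.hasCompactSupport_normed _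
  have hρ_int : ∫ x, ρ x = 1 := ContDiffBump.integral_normed _
  refine ⟨∫ x, ρ x * g x, ?_⟩
  have hsub : LocallyIntegrable (fun x => g x - ∫ x, ρ x * g x) volume :=
    hg.sub continuous_const.locallyIntegrable
  refine (ae_eq_zero_of_integral_contDiff_smul_eq_zero hsub fun ψ hψ hψ_supp => ?_).mono
    fun x hx => sub_eq_zero.1 hx
  have hψ_int := hψ.continuous.integrable_of_hasCompactSupport (μ := volume) hψ_supp
  have hρ_integrable := hρ.continuous.integrable_of_hasCompactSupport (μ := volume) hρ_supp
  have hψg : Integrable (fun x => ψ x * g x) volume :=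
    hg.integrable_smul_left_of_hasCompactSupport hψ.continuous hψ_supp
  have hρg : Integrable (fun x => ρ x * g x) volume :=
    hg.integrable_smul_left_of_hasCompactSupport hρ.continuous hρ_supp
  obtain ⟨φ, hφ, hφ_supp, hφ_deriv⟩ := exists_primitive_of_integral_eq_zero
    (η := fun x => ψ x - (∫ x, ψ x) * ρ x) (hψ.sub (contDiff_const.mul hρ))
    (hψ_supp.sub hρ_supp.mul_left) (by
      rw [integral_sub hψ_int (hρ_integrable.const_mul _), integral_const_mul, hρ_int, mul_one,
        sub_self])
  have hφ_zero := hg_zero φ hφ hφ_supp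
  simp only [hφ_deriv, sub_mul, mul_assoc] at hφ_zero
  rw [integral_sub hψg (hρg.const_mul _), integral_const_mul] at hφ_zero
  simp only [smul_eq_mul, mul_sub]
  rw [integral_sub hψg (hψ_int.mul_const _), integral_mul_const]
  exact hφ_zero

/-- The quadratic form of `-d²/dx² + x² + q`, polarised; `v` and `v₁` are the derivatives of `u`
and `u₁`, and are carried along because they only exist almost everywhere. -/
noncomputable def schrodingerForm (q u v u₁ v₁ : ℝ → ℝ) : ℝ :=
  ∫ x, (v x * v₁ x + (x * u x) * (x * u₁ x) + q x * (u x * u₁ x))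

theorem locallyIntegrable_sq_add {q : ℝ → ℝ} (hq : LocallyIntegrable q volume) :
    LocallyIntegrable (fun x => x ^ 2 + q x) volume :=
  (continuous_pow 2).locallyIntegrable.add hq

theorem ae_nonneg_sq_add {q : ℝ → ℝ} (hq₀ : ∀ᵐ x, 0 ≤ q x) : ∀ᵐ x : ℝ, 0 ≤ x ^ 2 + q x :=
  hq₀.mono fun x hx => add_nonneg (sq_nonneg x) hx

namespace IsSchrodingerL2Solution

variable {q u φ ψ : ℝ → ℝ} {μ : ℝ}

theorem harmonicFormDomain (hq₀ : ∀ᵐ x, 0 ≤ q x)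
    (h : IsSchrodingerL2Solution (fun x => x ^ 2 + q x) μ u) : HarmonicFormDomain u (deriv u) where
  prim := h.prim
  memLp := h.memLp
  memLp_deriv := h.memLp_deriv (ae_nonneg_sq_add hq₀)
  memLp_id_mul := by
    have hcont : Continuous fun x => x * u x := continuous_id.mul h.prim.continuous
    refine (memLp_two_iff_integrable_sq hcont.aestronglyMeasurable).2
      ((h.integrable_energy (ae_nonneg_sq_add hq₀)).mono' (hcont.pow 2).aestronglyMeasurable ?_)
    filter_upwards [hq₀] with x hx
    rw [Real.norm_of_nonneg (sq_nonneg _)]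
    nlinarith [mul_nonneg hx (sq_nonneg (u x)), sq_nonneg (deriv u x)]

end IsSchrodingerL2Solution

namespace HarmonicFormDomain

variable {q u v u₁ v₁ : ℝ → ℝ} {μ : ℝ}

theorem of_contDiff_of_hasCompactSupport {φ : ℝ → ℝ} (hφ : ContDiff ℝ 1 φ)
    (hφ_supp : HasCompactSupport φ) : HarmonicFormDomain φ (deriv φ) where
  prim := .of_hasDerivAt (fun x => (hφ.differentiable one_ne_zero x).hasDerivAt)
    (hφ.continuous_deriv le_rfl)
  memLp := hφ.continuous.memLp_of_hasCompactSupport hφ_supp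
  memLp_deriv := (hφ.continuous_deriv le_rfl).memLp_of_hasCompactSupport hφ_supp.deriv
  memLp_id_mul := (continuous_id.mul hφ.continuous).memLp_of_hasCompactSupport hφ_supp.mul_left

theorem integrable_form (hq : Integrable q volume) (h : HarmonicFormDomain u v)
    (h₁ : HarmonicFormDomain u₁ v₁) :
    Integrable (fun x => v x * v₁ x + (x * u x) * (x * u₁ x) + q x * (u x * u₁ x)) volume :=
  ((h.memLp_deriv.integrable_mul h₁.memLp_deriv).add
    (h.memLp_id_mul.integrable_mul h₁.memLp_id_mul)).add (h.integrable_mul_mul h₁ hq)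

theorem schrodingerForm_self (hq : Integrable q volume) (h : HarmonicFormDomain u v) :
    schrodingerForm q u v u v =
      (∫ x, v x ^ 2) + (∫ x, (x * u x) ^ 2) + ∫ x, q x * u x ^ 2 := by
  have hdiag : Integrable (fun x => v x ^ 2 + (x * u x) ^ 2) volume :=
    h.memLp_deriv.integrable_sq.add h.memLp_id_mul.integrable_sq
  have hpot : Integrable (fun x => q x * u x ^ 2) volume := by
    simpa only [pow_two] using h.integrable_mul_mul h hq
  rw [← integral_add h.memLp_deriv.integrable_sq h.memLp_id_mul.integrable_sq,
    ← integral_add hdiag hpot]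
  simp only [schrodingerForm, pow_two]

theorem schrodingerForm_sub_eq (hq : Integrable q volume) (h : HarmonicFormDomain u v)
    (h₁ : HarmonicFormDomain u₁ v₁) (μ : ℝ) :
    schrodingerForm q u v u₁ v₁ - μ * ∫ x, u x * u₁ x =
      ∫ x, ((x ^ 2 + q x - μ) * u x * u₁ x + v x * v₁ x) := by
  have hmass : Integrable (fun x => u x * u₁ x) volume := h.memLp.integrable_mul h₁.memLp
  rw [schrodingerForm, ← integral_const_mul,
    ← integral_sub (h.integrable_form hq h₁) (hmass.const_mul μ)]
  exact integral_congr_ae (.of_forall fun x => by ring)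

theorem integrable_weak_equation (hq : Integrable q volume) (h : HarmonicFormDomain u v)
    (h₁ : HarmonicFormDomain u₁ v₁) (μ : ℝ) :
    Integrable (fun x => (x ^ 2 + q x - μ) * u x * u₁ x + v x * v₁ x) volume := by
  have hmass : Integrable (fun x => u x * u₁ x) volume := h.memLp.integrable_mul h₁.memLp
  exact ((h.integrable_form hq h₁).sub (hmass.const_mul μ)).congr (.of_forall fun x => by
    simp only [Pi.sub_apply]; ring)

end HarmonicFormDomain

theorem IsSchrodingerL2Solution.schrodingerForm_eq {q u φ ψ : ℝ → ℝ} {μ : ℝ}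
    (hq : Integrable q volume) (hq₀ : ∀ᵐ x, 0 ≤ q x)
    (h : IsSchrodingerL2Solution (fun x => x ^ 2 + q x) μ u) (hφ : HarmonicFormDomain φ ψ) :
    schrodingerForm q u (deriv u) φ ψ = μ * ∫ x, u x * φ x := by
  have hdom := h.harmonicFormDomain hq₀
  rw [← sub_eq_zero, hdom.schrodingerForm_sub_eq hq hφ]
  exact (h.prim_deriv.mul hφ.prim).integral_eq_zero (hdom.integrable_weak_equation hq hφ μ)
    (hdom.memLp_deriv.integrable_mul hφ.memLp)

namespace HarmonicFormDomain

-- The weak equation says that `u'` and a primitive of `(x² + q - μ) u` differ by a constant.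
theorem exists_ae_eq_add_of_schrodingerForm_eq (hq : Integrable q volume)
    (h : HarmonicFormDomain u v)
    (hweak : ∀ φ ψ, HarmonicFormDomain φ ψ → schrodingerForm q u v φ ψ = μ * ∫ x, u x * φ x)
    {w : ℝ → ℝ} (hw : IsLocalPrimitive w fun x => (x ^ 2 + q x - μ) * u x) :
    ∃ m : ℝ, v =ᵐ[volume] fun x => m + w x := by
  have hv : LocallyIntegrable v volume := h.memLp_deriv.locallyIntegrable one_le_two
  obtain ⟨m, hm⟩ := ae_eq_const_of_integral_deriv_mul_eq_zero
    (hv.sub hw.continuous.locallyIntegrable) fun φ hφ hφ_supp => by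
      have hφ_dom := of_contDiff_of_hasCompactSupport (hφ.of_le (by simp)) hφ_supp
      have hprim := hw.mul hφ_dom.prim
      have hweak_int := h.integrable_weak_equation hq hφ_dom μ
      have hderiv_mul_v : Integrable (fun x => v x * deriv φ x) volume :=
        h.memLp_deriv.integrable_mul hφ_dom.memLp_deriv
      have hderiv_mul_w : Integrable (fun x => w x * deriv φ x) volume :=
        (hw.continuous.mul (hφ.continuous_deriv (by simp))).integrable_of_hasCompactSupport
          hφ_supp.deriv.mul_left
      have hw_int : Integrable
          (fun x => (x ^ 2 + q x - μ) * u x * φ x + w x * deriv φ x) volume :=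
        (hweak_int.sub (hderiv_mul_v.sub hderiv_mul_w)).congr (.of_forall fun x => by
          simp only [Pi.sub_apply]; ring)
      have hw_zero := hprim.integral_eq_zero hw_int
        ((hw.continuous.mul hφ.continuous).integrable_of_hasCompactSupport hφ_supp.mul_left)
      have hv_zero := (h.schrodingerForm_sub_eq hq hφ_dom μ).symm.trans
        (sub_eq_zero.2 (hweak φ _ hφ_dom))
      rw [← sub_zero (0 : ℝ)]
      nth_rewrite 1 [← hv_zero]
      rw [← hw_zero, ← integral_sub hweak_int hw_int]
      refine integral_congr_ae (.of_forall fun x => ?_)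
      simp only [Pi.sub_apply]
      ring
  exact ⟨m, hm.mono fun x hx => (sub_eq_iff_eq_add.1 hx)⟩

theorem isSchrodingerL2Solution (hq : Integrable q volume) (h : HarmonicFormDomain u v)
    (hweak : ∀ φ ψ, HarmonicFormDomain φ ψ → schrodingerForm q u v φ ψ = μ * ∫ x, u x * φ x) :
    IsSchrodingerL2Solution (fun x => x ^ 2 + q x) μ u := by
  have hW : LocallyIntegrable (fun x => (x ^ 2 + q x - μ) * u x) volume :=
    ((locallyIntegrable_sq_add hq.locallyIntegrable).sub
      continuous_const.locallyIntegrable).mul_continuous h.continuous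
  obtain ⟨m, hm⟩ := h.exists_ae_eq_add_of_schrodingerForm_eq hq hweak (.integral hW 0)
  set w : ℝ → ℝ := fun x => m + ∫ t in (0 : ℝ)..x, (t ^ 2 + q t - μ) * u t
  have hw : IsLocalPrimitive w fun x => (x ^ 2 + q x - μ) * u x :=
    (IsLocalPrimitive.integral hW 0).const_add m
  have hderiv : ∀ x, HasDerivAt u (w x) x := (h.prim.congr hm).hasDerivAt hw.continuous
  have hderiv_eq : deriv u = w := funext fun x => (hderiv x).deriv
  refine ⟨fun x => (hderiv x).differentiableAt, fun a b => ?_, ?_, h.memLp⟩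
  · exact hderiv_eq ▸ hw.absolutelyContinuousOnInterval a b
  · filter_upwards [hw.ae_hasDerivAt] with x hx
    rw [hderiv_eq, hx.deriv]
    exact ⟨hx.differentiableAt, by ring⟩

end HarmonicFormDomain

/-! ### Compactness and completeness of the eigenfunctions -/

section CompactEmbedding

variable {H K : Type*} [NormedAddCommGroup H] [InnerProductSpace ℝ H]
  [NormedAddCommGroup K] [InnerProductSpace ℝ K]

theorem isCompactOperator_sum_smulRight {ι : Type*} (s : Finset ι) (e : ι → K) :
    IsCompactOperator (∑ k ∈ s, (innerSL ℝ (e k)).smulRight (e k) : K →L[ℝ] K) := by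
  classical
  induction s using Finset.induction_on with
  | empty => simpa using isCompactOperator_zero
  | insert k s hk ih =>
    rw [Finset.sum_insert hk]
    have hrank_one : IsCompactOperator
        (((ContinuousLinearMap.id ℝ ℝ).smulRight (e k)) ∘L (innerSL ℝ (e k)) : K →L[ℝ] K) :=
      (isCompactOperator_of_locallyCompactSpace_rng
        ((ContinuousLinearMap.id ℝ ℝ).smulRight (e k))).comp_clm _
    exact IsCompactOperator.add hrank_one ih

theorem norm_sub_sum_inner_smul_sq {ι : Type*} {e : ι → K} (he : Orthonormal ℝ e)
    (s : Finset ι) (x : K) :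
    ‖x - ∑ k ∈ s, inner ℝ (e k) x • e k‖ ^ 2 = ‖x‖ ^ 2 - ∑ k ∈ s, inner ℝ (e k) x ^ 2 := by
  have hproj : ‖∑ k ∈ s, inner ℝ (e k) x • e k‖ ^ 2 = ∑ k ∈ s, inner ℝ (e k) x ^ 2 := by
    rw [← real_inner_self_eq_norm_sq, he.inner_sum]
    simp [pow_two]
  have hcross : inner ℝ x (∑ k ∈ s, inner ℝ (e k) x • e k) = ∑ k ∈ s, inner ℝ (e k) x ^ 2 := by
    simp only [inner_sum, real_inner_smul_right, real_inner_comm x, pow_two]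
  rw [norm_sub_sq_real, hproj, hcross]
  ring

theorem isCompactOperator_of_mul_norm_sq_sub_sum_le [CompleteSpace K] {e : ℕ → K}
    (he : Orthonormal ℝ e) {J : H →L[ℝ] K} {C : ℝ}
    (hJ : ∀ (N : ℕ) z,
      N * (‖J z‖ ^ 2 - ∑ k ∈ Finset.range N, inner ℝ (e k) (J z) ^ 2) ≤ C * ‖z‖ ^ 2) :
    IsCompactOperator J := by
  set P : ℕ → K →L[ℝ] K := fun N => ∑ k ∈ Finset.range N, (innerSL ℝ (e k)).smulRight (e k)
  have hcompact : ∀ N, IsCompactOperator (P N ∘L J) := fun N =>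
    (isCompactOperator_sum_smulRight _ e).comp_clm J
  have hnorm : ∀ᶠ N : ℕ in atTop, ‖P N ∘L J - J‖ ≤ √(C / N) := by
    filter_upwards [eventually_gt_atTop 0] with N hN
    refine ContinuousLinearMap.opNorm_le_bound _ (Real.sqrt_nonneg _) fun z => ?_
    have hN' : (0 : ℝ) < N := Nat.cast_pos.2 hN
    have hle : ‖(P N ∘L J - J) z‖ ^ 2 ≤ C / N * ‖z‖ ^ 2 := by
      have heq : ‖(P N ∘L J - J) z‖ ^ 2 =
          ‖J z‖ ^ 2 - ∑ k ∈ Finset.range N, inner ℝ (e k) (J z) ^ 2 := by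
        rw [← norm_sub_sum_inner_smul_sq he, ← norm_neg]
        simp [P]
      rw [heq, div_mul_eq_mul_div, le_div_iff₀' hN']
      exact hJ N z
    calc ‖(P N ∘L J - J) z‖ ≤ √(C / N * ‖z‖ ^ 2) := Real.le_sqrt_of_sq_le hle
      _ = √(C / N) * ‖z‖ := by
        rw [Real.sqrt_mul' _ (sq_nonneg _), Real.sqrt_sq (norm_nonneg _)]
  have hlim : Tendsto (fun N : ℕ => √(C / N)) atTop (𝓝 0) := by
    simpa using (tendsto_const_div_atTop_nhds_zero_nat C).sqrt
  exact isCompactOperator_of_tendsto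
    (tendsto_iff_norm_sub_tendsto_zero.2 (squeeze_zero' (.of_forall fun _ => norm_nonneg _)
      hnorm hlim)) (.of_forall hcompact)

theorem eq_zero_of_inner_eigenvector_eq_zero [CompleteSpace H] [CompleteSpace K] {J : H →L[ℝ] K}
    (hJ : IsCompactOperator J) (hdense : ∀ g, (∀ z, inner ℝ (J z) g = 0) → g = 0) {f : K}
    (hf : ∀ z ν, ν ≠ 0 → (∀ w, inner ℝ (J z) (J w) = ν * inner ℝ z w) → inner ℝ (J z) f = 0) :
    f = 0 := by
  set A := ContinuousLinearMap.adjoint J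
  have hsymm : (J ∘L A : K →ₗ[ℝ] K).IsSymmetric := fun x y => by
    simp only [ContinuousLinearMap.coe_coe, ContinuousLinearMap.comp_apply]
    rw [← ContinuousLinearMap.adjoint_inner_right, ContinuousLinearMap.adjoint_inner_left]
  rw [← Submodule.mem_bot ℝ, ← ContinuousLinearMap.orthogonalComplement_iSup_eigenspaces_eq_bot
    (hJ.comp_clm A) hsymm, ← Submodule.iInf_orthogonal, Submodule.mem_iInf]
  intro ν
  rw [Submodule.mem_orthogonal]
  intro g hg
  have hg : J (A g) = ν • g := Module.End.mem_eigenspace_iff.1 hg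
  obtain rfl | hν := eq_or_ne ν 0
  · have hAg : A g = 0 := by
      rw [← inner_self_eq_zero (𝕜 := ℝ), ContinuousLinearMap.adjoint_inner_right, hg, zero_smul,
        inner_zero_left]
    rw [hdense g fun z => by
      rw [← ContinuousLinearMap.adjoint_inner_right, hAg, inner_zero_right], inner_zero_left]
  · have hAg := hf (A g) ν hν fun w => by
      rw [hg, real_inner_smul_left, ContinuousLinearMap.adjoint_inner_left]
    rw [hg, real_inner_smul_left] at hAg
    exact (mul_eq_zero.1 hAg).resolve_left hν

end CompactEmbedding

/-- The quadruple `(u, u', x u, √q u)`. The norm of its class in `L²(ℝ)⁴` is the form norm of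
`-d²/dx² + x² + q + 1`. -/
noncomputable def formVector (q u v : ℝ → ℝ) : Fin 4 → ℝ → ℝ :=
  ![u, v, fun x => x * u x, fun x => √(q x) * u x]

theorem formVector_add (q u v u₁ v₁ : ℝ → ℝ) (i : Fin 4) (x : ℝ) :
    formVector q (fun x => u x + u₁ x) (fun x => v x + v₁ x) i x =
      formVector q u v i x + formVector q u₁ v₁ i x := by
  fin_cases i <;> simp [formVector, mul_add]

theorem formVector_const_mul (q u v : ℝ → ℝ) (c : ℝ) (i : Fin 4) (x : ℝ) :
    formVector q (fun x => c * u x) (fun x => c * v x) i x = c * formVector q u v i x := by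
  fin_cases i <;> simp [formVector, mul_left_comm]

/-- `z` is the class of `formVector q u v` for a pair `(u, v)` in the form domain. -/
structure RepresentsForm (q : ℝ → ℝ) (z : PiLp 2 fun _ : Fin 4 => Lp ℝ 2 (volume : Measure ℝ))
    (u v : ℝ → ℝ) : Prop where
  dom : HarmonicFormDomain u v
  ae_eq : ∀ i, z i =ᵐ[volume] formVector q u v i

/-- The form domain of `-d²/dx² + x² + q`, as a Hilbert space inside `L²(ℝ)⁴`. -/
def formSpace (q : ℝ → ℝ) :
    Submodule ℝ (PiLp 2 fun _ : Fin 4 => Lp ℝ 2 (volume : Measure ℝ)) where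
  carrier := {z | ∃ u v, RepresentsForm q z u v}
  zero_mem' := ⟨_, _, .zero, fun i => (Lp.coeFn_zero ℝ 2 volume).trans (.of_forall fun x => by
    fin_cases i <;> simp [formVector])⟩
  add_mem' := by
    rintro z w ⟨u, v, h⟩ ⟨u₁, v₁, h₁⟩
    refine ⟨_, _, h.dom.add h₁.dom, fun i => ?_⟩
    filter_upwards [Lp.coeFn_add (z i) (w i), h.ae_eq i, h₁.ae_eq i] with x hadd hz hw
    rw [PiLp.add_apply, hadd, Pi.add_apply, hz, hw, formVector_add]
  smul_mem' := by
    rintro c z ⟨u, v, h⟩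
    refine ⟨_, _, h.dom.const_mul c, fun i => ?_⟩
    filter_upwards [Lp.coeFn_smul c (z i), h.ae_eq i] with x hsmul hz
    rw [PiLp.smul_apply, hsmul, Pi.smul_apply, hz, smul_eq_mul, formVector_const_mul]

section FormSpace

variable {q u v u₁ v₁ : ℝ → ℝ}

theorem HarmonicFormDomain.memLp_formVector (hq : Integrable q volume) (hq₀ : ∀ᵐ x, 0 ≤ q x)
    (h : HarmonicFormDomain u v) (i : Fin 4) : MemLp (formVector q u v i) 2 volume := by
  have hsqrt : MemLp (fun x => √(q x) * u x) 2 volume := by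
    refine (memLp_two_iff_integrable_sq ?_).2 ((h.integrable_mul_mul h hq).congr ?_)
    · exact (Real.continuous_sqrt.comp_aestronglyMeasurable hq.aestronglyMeasurable).mul
        h.continuous.aestronglyMeasurable
    · filter_upwards [hq₀] with x hx
      rw [mul_pow, Real.sq_sqrt hx, pow_two]
  fin_cases i
  exacts [h.memLp, h.memLp_deriv, h.memLp_id_mul, hsqrt]

theorem HarmonicFormDomain.exists_representsForm (hq : Integrable q volume)
    (hq₀ : ∀ᵐ x, 0 ≤ q x) (h : HarmonicFormDomain u v) : ∃ z, RepresentsForm q z u v :=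
  ⟨WithLp.toLp 2 fun i => (h.memLp_formVector hq hq₀ i).toLp _, h, fun i =>
    (h.memLp_formVector hq hq₀ i).coeFn_toLp⟩

theorem inner_eq_integral_of_ae_eq {α : Type*} [MeasurableSpace α] {ν : Measure α}
    {f g : Lp ℝ 2 ν} {a b : α → ℝ} (hf : f =ᵐ[ν] a) (hg : g =ᵐ[ν] b) :
    inner ℝ f g = ∫ x, a x * b x ∂ν := by
  rw [← Lp.toLp_coeFn f (Lp.memLp f), ← Lp.toLp_coeFn g (Lp.memLp g), inner_toLp_toLp]
  exact integral_congr_ae (hf.mul hg)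

theorem RepresentsForm.inner_eq {z w : PiLp 2 fun _ : Fin 4 => Lp ℝ 2 (volume : Measure ℝ)}
    (hq : Integrable q volume) (hq₀ : ∀ᵐ x, 0 ≤ q x) (h : RepresentsForm q z u v)
    (h₁ : RepresentsForm q w u₁ v₁) :
    inner ℝ z w = (∫ x, u x * u₁ x) + schrodingerForm q u v u₁ v₁ := by
  have hint : ∀ i, Integrable (fun x => formVector q u v i x * formVector q u₁ v₁ i x) volume :=
    fun i => (h.dom.memLp_formVector hq hq₀ i).integrable_mul (h₁.dom.memLp_formVector hq hq₀ i)
  have hmass : Integrable (fun x => u x * u₁ x) volume := hint 0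
  rw [PiLp.inner_apply, schrodingerForm, ← integral_add hmass (h.dom.integrable_form hq h₁.dom)]
  simp only [fun i => inner_eq_integral_of_ae_eq (h.ae_eq i) (h₁.ae_eq i)]
  rw [← integral_finsetSum _ fun i _ => hint i]
  refine integral_congr_ae ?_
  filter_upwards [hq₀] with x hx
  rw [Fin.sum_univ_four]
  simp only [formVector, Matrix.cons_val]
  linear_combination (u x * u₁ x) * Real.mul_self_sqrt hx

end FormSpace

theorem ae_eq_of_tendsto_Lp_of_ae_tendsto {α : Type*} [MeasurableSpace α] {ν : Measure α}
    {F : ℕ → Lp ℝ 2 ν} {f : Lp ℝ 2 ν} {G : ℕ → α → ℝ} {g : α → ℝ}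
    (hF : Tendsto F atTop (𝓝 f)) (hG : ∀ n, F n =ᵐ[ν] G n)
    (hg : ∀ᵐ x ∂ν, Tendsto (fun n => G n x) atTop (𝓝 (g x))) : f =ᵐ[ν] g := by
  obtain ⟨ns, hns, hlim⟩ := (tendstoInMeasure_of_tendsto_Lp hF).exists_seq_tendsto_ae
  filter_upwards [hlim, ae_all_iff.2 hG, hg] with x hlim_x hG_x hg_x
  exact tendsto_nhds_unique hlim_x
    ((hg_x.comp hns.tendsto_atTop).congr fun n => (hG_x (ns n)).symm)

theorem tendsto_intervalIntegral_of_tendsto_Lp {F : ℕ → Lp ℝ 2 (volume : Measure ℝ)}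
    {f : Lp ℝ 2 (volume : Measure ℝ)} (hF : Tendsto F atTop (𝓝 f)) (a b : ℝ) :
    Tendsto (fun n => ∫ x in a..b, F n x) atTop (𝓝 (∫ x in a..b, f x)) := by
  have htendsto : ∀ a b : ℝ, Tendsto (fun n => ∫ x in Set.Ioc a b, F n x) atTop
      (𝓝 (∫ x in Set.Ioc a b, f x)) := fun a b => by
    have hfinite : volume (Set.Ioc a b) ≠ ⊤ := by simp
    simpa only [L2.inner_indicatorConstLp_one] using (tendsto_const_nhds
      (x := indicatorConstLp 2 measurableSet_Ioc hfinite (1 : ℝ))).inner (𝕜 := ℝ) hF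
  exact (htendsto a b).sub (htendsto b a)

theorem exists_seq_tendsto_isLocalPrimitive {F G : ℕ → Lp ℝ 2 (volume : Measure ℝ)}
    {f g : Lp ℝ 2 (volume : Measure ℝ)} {u v : ℕ → ℝ → ℝ} (hF : Tendsto F atTop (𝓝 f))
    (hG : Tendsto G atTop (𝓝 g)) (hu : ∀ n, F n =ᵐ[volume] u n) (hv : ∀ n, G n =ᵐ[volume] v n)
    (huv : ∀ n, IsLocalPrimitive (u n) (v n)) :
    ∃ (ns : ℕ → ℕ) (u₀ : ℝ → ℝ), StrictMono ns ∧ IsLocalPrimitive u₀ g ∧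
      ∀ x, Tendsto (fun k => u (ns k) x) atTop (𝓝 (u₀ x)) := by
  obtain ⟨ns, hns, hae⟩ := (tendstoInMeasure_of_tendsto_Lp hF).exists_seq_tendsto_ae
  obtain ⟨x₀, hx₀⟩ : ∃ x₀, Tendsto (fun k => u (ns k) x₀) atTop (𝓝 (f x₀)) := by
    refine Eventually.exists (f := ae volume) ?_
    filter_upwards [hae, ae_all_iff.2 hu] with x hlim hu_x
    exact hlim.congr fun k => hu_x (ns k)
  have hg : LocallyIntegrable g volume := (Lp.memLp g).locallyIntegrable (by norm_num)
  refine ⟨ns, _, hns, (IsLocalPrimitive.integral hg x₀).const_add (f x₀), fun x => ?_⟩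
  refine (hx₀.add ((tendsto_intervalIntegral_of_tendsto_Lp hG x₀ x).comp
    hns.tendsto_atTop)).congr fun k => ?_
  rw [congrFun ((huv (ns k)).eq_add x₀) x, Function.comp_apply]
  exact congrArg _ (intervalIntegral.integral_congr_ae ((hv (ns k)).mono fun t ht _ => ht))

theorem isClosed_formSpace (q : ℝ → ℝ) : IsClosed (SetLike.coe (formSpace q)) := by
  refine IsSeqClosed.isClosed fun z z₀ hz hlim => ?_
  choose u v h using hz
  have hcoord : ∀ i, Tendsto (fun n => z n i) atTop (𝓝 (z₀ i)) := fun i =>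
    ((PiLp.continuous_apply 2 _ i).tendsto z₀).comp hlim
  obtain ⟨ns, u₀, hns, hu₀, hpointwise⟩ := exists_seq_tendsto_isLocalPrimitive (hcoord 0)
    (hcoord 1) (fun n => (h n).ae_eq 0) (fun n => (h n).ae_eq 1) fun n => (h n).dom.prim
  have hae : ∀ i, i ≠ 1 → z₀ i =ᵐ[volume] formVector q u₀ (z₀ 1) i := fun i hi => by
    refine ae_eq_of_tendsto_Lp_of_ae_tendsto ((hcoord i).comp hns.tendsto_atTop)
      (fun k => (h (ns k)).ae_eq i) (.of_forall fun x => ?_)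
    fin_cases i
    exacts [hpointwise x, (hi rfl).elim, (hpointwise x).const_mul x,
      (hpointwise x).const_mul (√(q x))]
  have hmemLp : ∀ i, i ≠ 1 → MemLp (formVector q u₀ (z₀ 1) i) 2 volume := fun i hi =>
    (memLp_congr_ae (hae i hi)).1 (Lp.memLp _)
  refine ⟨u₀, z₀ 1, ⟨hu₀, hmemLp 0 (by decide), Lp.memLp _, hmemLp 2 (by decide)⟩, fun i => ?_⟩
  obtain rfl | hi := eq_or_ne i 1
  exacts [.rfl, hae i hi]

instance (q : ℝ → ℝ) : CompleteSpace (formSpace q) :=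
  (isClosed_formSpace q).completeSpace_coe

/-- The embedding of the form domain into `L²(ℝ)`. -/
noncomputable def formEmbedding (q : ℝ → ℝ) :
    formSpace q →L[ℝ] Lp ℝ 2 (volume : Measure ℝ) :=
  PiLp.proj 2 (fun _ : Fin 4 => Lp ℝ 2 (volume : Measure ℝ)) 0 ∘L (formSpace q).subtypeL

theorem orthonormal_toLp_hermiteFun :
    Orthonormal ℝ fun k => (memLp_hermiteFun k).toLp (hermiteFun k) :=
  orthonormal_iff_ite.2 fun j k => by rw [inner_toLp_toLp, integral_hermiteFun_mul_hermiteFun]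

theorem sum_sq_integral_mul_hermiteFun_le {f : ℝ → ℝ} (hf : MemLp f 2 volume) (s : Finset ℕ) :
    ∑ k ∈ s, (∫ x, f x * hermiteFun k x) ^ 2 ≤ ∫ x, f x ^ 2 :=
  sum_le_hasSum s (fun _ _ => sq_nonneg _) (hasSum_sq_integral_mul_hermiteFun hf)

section Completeness

variable {q : ℝ → ℝ}

theorem isCompactOperator_formEmbedding (hq : Integrable q volume) (hq₀ : ∀ᵐ x, 0 ≤ q x) :
    IsCompactOperator (formEmbedding q) := by
  refine isCompactOperator_of_mul_norm_sq_sub_sum_le orthonormal_toLp_hermiteFun (C := 1 / 2)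
    fun N z => ?_
  obtain ⟨u, v, h⟩ := z.2
  have hval : formEmbedding q z =ᵐ[volume] u := h.ae_eq 0
  have hnorm : ‖z‖ ^ 2 = (∫ x, u x * u x) + schrodingerForm q u v u v := by
    rw [← h.inner_eq hq hq₀ h, ← real_inner_self_eq_norm_sq, Submodule.coe_inner]
  have hq_nonneg : 0 ≤ ∫ x, q x * u x ^ 2 :=
    integral_nonneg_of_ae (hq₀.mono fun x hx => mul_nonneg hx (sq_nonneg _))
  have hmass_nonneg : 0 ≤ ∫ x, u x ^ 2 := integral_nonneg fun x => sq_nonneg _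
  rw [hnorm, h.dom.schrodingerForm_self hq, ← real_inner_self_eq_norm_sq]
  simp only [inner_eq_integral_of_ae_eq hval hval,
    fun k => inner_eq_integral_of_ae_eq (memLp_hermiteFun k).coeFn_toLp hval]
  simp only [mul_comm (hermiteFun _ _), ← pow_two]
  linarith [h.dom.energy_ge N, sum_sq_integral_mul_hermiteFun_le h.dom.memLp (Finset.range N)]

theorem ae_eq_zero_of_forall_integral_mul_eigenfunction_eq_zero (hq : Integrable q volume)
    (hq₀ : ∀ᵐ x, 0 ≤ q x) {f : ℝ → ℝ} (hf : MemLp f 2 volume)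
    (h : ∀ μ u, IsSchrodingerL2Solution (fun x => x ^ 2 + q x) μ u → ∫ x, f x * u x = 0) :
    f =ᵐ[volume] 0 := by
  have hdense : ∀ g, (∀ z, inner ℝ (formEmbedding q z) g = 0) → g = 0 := fun g hg => by
    refine (Lp.eq_zero_iff_ae_eq_zero).2 (ae_eq_zero_of_integral_mul_hermiteFun_eq_zero
      (Lp.memLp g) fun k => ?_)
    obtain ⟨z, hz⟩ := (harmonicFormDomain_hermiteFun k).exists_representsForm hq hq₀
    exact (inner_eq_integral_of_ae_eq .rfl (hz.ae_eq 0)).symm.trans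
      ((real_inner_comm _ _).trans (hg ⟨z, _, _, hz⟩))
  have hzero : hf.toLp f = 0 := by
    refine eq_zero_of_inner_eigenvector_eq_zero (isCompactOperator_formEmbedding hq hq₀) hdense
      fun z ν hν hz => ?_
    obtain ⟨u, v, hu⟩ := z.2
    have hval : formEmbedding q z =ᵐ[volume] u := hu.ae_eq 0
    rw [real_inner_comm, inner_eq_integral_of_ae_eq hf.coeFn_toLp hval]
    refine h (ν⁻¹ - 1) u (hu.dom.isSchrodingerL2Solution hq fun φ ψ hφ => ?_)
    obtain ⟨w, hw⟩ := hφ.exists_representsForm hq hq₀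
    have hinner : (∫ x, u x * φ x) = ν * ((∫ x, u x * φ x) + schrodingerForm q u v φ ψ) := by
      rw [← hu.inner_eq hq hq₀ hw]
      exact (inner_eq_integral_of_ae_eq (hu.ae_eq 0) (hw.ae_eq 0)).symm.trans (hz ⟨w, _, _, hw⟩)
    field_simp
    linarith
  exact hf.coeFn_toLp.symm.trans (hzero ▸ Lp.coeFn_zero ℝ 2 volume)

end Completeness

section FormAlgebra

variable {q u v u₁ v₁ : ℝ → ℝ}

theorem schrodingerForm_comm (q u v u₁ v₁ : ℝ → ℝ) :
    schrodingerForm q u v u₁ v₁ = schrodingerForm q u₁ v₁ u v :=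
  integral_congr_ae (.of_forall fun x => by ring)

theorem schrodingerForm_self_nonneg (hq₀ : ∀ᵐ x, 0 ≤ q x) : 0 ≤ schrodingerForm q u v u v := by
  refine integral_nonneg_of_ae (hq₀.mono fun x hx => ?_)
  simp only [Pi.zero_apply]
  nlinarith [mul_nonneg hx (mul_self_nonneg (u x)), mul_self_nonneg (v x),
    mul_self_nonneg (x * u x)]

theorem integral_sum_mul {α ι : Type*} [MeasurableSpace α] {ν : Measure α} (s : Finset ι)
    (c : ι → ℝ) {u : ι → α → ℝ} {f : α → ℝ} (h : ∀ i, MemLp (u i) 2 ν) (hf : MemLp f 2 ν) :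
    ∫ x, (∑ i ∈ s, c i * u i x) * f x ∂ν = ∑ i ∈ s, c i * ∫ x, u i x * f x ∂ν := by
  have hint : ∀ i, Integrable (fun x => u i x * f x) ν := fun i => (h i).integrable_mul hf
  simp only [← integral_const_mul, Finset.sum_mul, mul_assoc]
  exact integral_finsetSum s fun i _ => (hint i).const_mul (c i)

theorem schrodingerForm_sum {ι : Type*} (s : Finset ι) (c : ι → ℝ) {U V : ι → ℝ → ℝ}
    (hq : Integrable q volume) (h : ∀ i, HarmonicFormDomain (U i) (V i))
    (h₁ : HarmonicFormDomain u v) :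
    schrodingerForm q (fun x => ∑ i ∈ s, c i * U i x) (fun x => ∑ i ∈ s, c i * V i x) u v =
      ∑ i ∈ s, c i * schrodingerForm q (U i) (V i) u v := by
  simp only [schrodingerForm, ← integral_const_mul]
  rw [← integral_finsetSum s fun i _ => ((h i).integrable_form hq h₁).const_mul (c i)]
  refine integral_congr_ae (.of_forall fun x => ?_)
  simp only [Finset.mul_sum, Finset.sum_mul, ← Finset.sum_add_distrib]
  exact Finset.sum_congr rfl fun i _ => by ring

theorem schrodingerForm_sub_self (hq : Integrable q volume) (h : HarmonicFormDomain u v)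
    (h₁ : HarmonicFormDomain u₁ v₁) :
    schrodingerForm q (fun x => u x - u₁ x) (fun x => v x - v₁ x) (fun x => u x - u₁ x)
      (fun x => v x - v₁ x) = schrodingerForm q u v u v - 2 * schrodingerForm q u₁ v₁ u v +
        schrodingerForm q u₁ v₁ u₁ v₁ := by
  have hself := h.integrable_form hq h
  have hcross := (h₁.integrable_form hq h).const_mul 2
  have hself₁ := h₁.integrable_form hq h₁
  simp only [schrodingerForm]
  rw [← integral_const_mul, ← integral_sub hself hcross,
    ← integral_add (by exact hself.sub hcross) hself₁]
  exact integral_congr_ae (.of_forall fun x => by ring)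

end FormAlgebra

/-! ### Bounds for the eigenvalues -/

/-- The set of eigenvalues of `-d²/dx² + V` on `L²(ℝ)`. -/
def schrodingerEigenvalues (V : ℝ → ℝ) : Set ℝ :=
  {μ | ∃ u, IsSchrodingerL2Solution V μ u ∧ u ≠ 0}

namespace IsSchrodingerL2Solution

variable {V u : ℝ → ℝ} {μ : ℝ}

theorem integral_mul_self_pos (h : IsSchrodingerL2Solution V μ u) (hu : u ≠ 0) :
    0 < ∫ x, u x * u x := by
  have hcont := h.differentiable.continuous
  obtain ⟨x, hx⟩ := Function.ne_iff.1 hu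
  exact integral_pos_of_integrable_nonneg_nonzero (hcont.mul hcont)
    (h.memLp.integrable_mul h.memLp) (fun x => mul_self_nonneg _) (mul_self_ne_zero.2 hx)

theorem exists_integral_mul_self_eq_one (h : IsSchrodingerL2Solution V μ u) (hu : u ≠ 0) :
    ∃ e, IsSchrodingerL2Solution V μ e ∧ ∫ x, e x * e x = 1 := by
  have hpos := h.integral_mul_self_pos hu
  refine ⟨(√(∫ x, u x * u x))⁻¹ • u, (schrodingerEigenspace V μ).smul_mem _ h, ?_⟩
  simp only [Pi.smul_apply, smul_eq_mul, mul_assoc, mul_left_comm (u _)]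
  rw [integral_const_mul, integral_const_mul, ← mul_assoc, ← mul_inv,
    Real.mul_self_sqrt hpos.le, inv_mul_cancel₀ hpos.ne']

theorem countable_zeros (hV : LocallyIntegrable V volume) (h : IsSchrodingerL2Solution V μ u)
    (hu : u ≠ 0) : {x | u x = 0}.Countable := by
  have hdiscrete : DiscreteTopology {x | u x = 0} := by
    rw [discreteTopology_subtype_iff]
    intro x hx
    rw [← disjoint_iff, disjoint_principal_right]
    exact (h.differentiable x).hasDerivAt.eventually_ne (c := 0)
      fun hderiv => hu (h.eq_zero_of_initial hV hx hderiv)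
  exact Set.countable_coe_iff.1 countable_of_Lindelof_of_discrete

variable {q v : ℝ → ℝ} {ν : ℝ}

theorem integral_potential_mul_sq_pos (hq : Integrable q volume) (hq₀ : ∀ᵐ x, 0 ≤ q x)
    (hq_ne : ∫ x, q x ≠ 0) (h : IsSchrodingerL2Solution (fun x => x ^ 2 + q x) μ u)
    (hu : u ≠ 0) : 0 < ∫ x, q x * u x ^ 2 := by
  have hdom := h.harmonicFormDomain hq₀
  have hnonneg : 0 ≤ᵐ[volume] fun x => q x * u x ^ 2 :=
    hq₀.mono fun x hx => mul_nonneg hx (sq_nonneg _)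
  have hint : Integrable (fun x => q x * u x ^ 2) volume := by
    simpa only [pow_two] using hdom.integrable_mul_mul hdom hq
  refine (integral_nonneg_of_ae hnonneg).lt_of_ne fun hzero => hq_ne (integral_eq_zero_of_ae ?_)
  have hu_ne : ∀ᵐ x, u x ≠ 0 := compl_mem_ae_iff.2
    ((h.countable_zeros (locallyIntegrable_sq_add hq.locallyIntegrable) hu).measure_zero volume)
  filter_upwards [(integral_eq_zero_iff_of_nonneg_ae hnonneg hint).1 hzero.symm, hu_ne]
    with x hx hux
  simpa [hux] using hx

theorem integral_mul_eq_zero (hq : Integrable q volume) (hq₀ : ∀ᵐ x, 0 ≤ q x)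
    (h : IsSchrodingerL2Solution (fun x => x ^ 2 + q x) μ u)
    (h₁ : IsSchrodingerL2Solution (fun x => x ^ 2 + q x) ν v) (hne : μ ≠ ν) :
    ∫ x, u x * v x = 0 := by
  have huv := h.schrodingerForm_eq hq hq₀ (h₁.harmonicFormDomain hq₀)
  have hvu := h₁.schrodingerForm_eq hq hq₀ (h.harmonicFormDomain hq₀)
  simp only [mul_comm (v _)] at hvu
  rw [schrodingerForm_comm, huv, ← sub_eq_zero, ← sub_mul] at hvu
  exact (mul_eq_zero.1 hvu).resolve_left (sub_ne_zero.2 hne)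

end IsSchrodingerL2Solution

/-- An orthonormal family in `L²(ℝ)` of eigenfunctions `e i` of `-d²/dx² + x² + q`, with
eigenvalues `μ i`. -/
structure IsOrthonormalEigenfamily {ι : Type*} [DecidableEq ι] (q : ℝ → ℝ) (μ : ι → ℝ)
    (e : ι → ℝ → ℝ) : Prop where
  solution : ∀ i, IsSchrodingerL2Solution (fun x => x ^ 2 + q x) (μ i) (e i)
  integral_mul : ∀ i j, ∫ x, e i x * e j x = if i = j then 1 else 0

namespace IsOrthonormalEigenfamily

variable {ι : Type*} [DecidableEq ι] {q φ ψ : ℝ → ℝ} {μ : ι → ℝ} {e : ι → ℝ → ℝ}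

theorem exists_of_injective (hq : Integrable q volume) (hq₀ : ∀ᵐ x, 0 ≤ q x)
    (hμ : Function.Injective μ)
    (hmem : ∀ i, μ i ∈ schrodingerEigenvalues fun x => x ^ 2 + q x) :
    ∃ e, IsOrthonormalEigenfamily q μ e := by
  choose u hu hu_ne using hmem
  choose e he he_norm using fun i => (hu i).exists_integral_mul_self_eq_one (hu_ne i)
  refine ⟨e, he, fun i j => ?_⟩
  split_ifs with hij
  · rw [hij, he_norm]
  · exact (he i).integral_mul_eq_zero hq hq₀ (he j) (hμ.ne hij)

theorem integral_sum_mul_eq (h : IsOrthonormalEigenfamily q μ e) (s : Finset ι) (c : ι → ℝ)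
    {i : ι} (hi : i ∈ s) : ∫ x, (∑ j ∈ s, c j * e j x) * e i x = c i := by
  rw [integral_sum_mul s c (fun j => (h.solution j).memLp) (h.solution i).memLp]
  simp [h.integral_mul, hi]

theorem memLp_sum (h : IsOrthonormalEigenfamily q μ e) (s : Finset ι) (c : ι → ℝ) :
    MemLp (fun x => ∑ i ∈ s, c i * e i x) 2 volume :=
  memLp_finsetSum s fun i _ => (h.solution i).memLp.const_mul (c i)

theorem integral_sum_sq (h : IsOrthonormalEigenfamily q μ e) (s : Finset ι) (c : ι → ℝ) :
    ∫ x, (∑ i ∈ s, c i * e i x) ^ 2 = ∑ i ∈ s, c i ^ 2 := by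
  simp only [pow_two]
  rw [integral_sum_mul s c (fun i => (h.solution i).memLp) (h.memLp_sum s c)]
  refine Finset.sum_congr rfl fun i hi => ?_
  simp only [mul_comm (e i _)]
  rw [h.integral_sum_mul_eq s c hi]

theorem harmonicFormDomain_sum (hq₀ : ∀ᵐ x, 0 ≤ q x) (h : IsOrthonormalEigenfamily q μ e)
    (s : Finset ι) (c : ι → ℝ) : HarmonicFormDomain (fun x => ∑ i ∈ s, c i * e i x)
      (fun x => ∑ i ∈ s, c i * deriv (e i) x) :=
  .sum_mul s c fun i => (h.solution i).harmonicFormDomain hq₀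

theorem schrodingerForm_sum_eq (hq : Integrable q volume) (hq₀ : ∀ᵐ x, 0 ≤ q x)
    (h : IsOrthonormalEigenfamily q μ e) (s : Finset ι) (c : ι → ℝ)
    (hφ : HarmonicFormDomain φ ψ) :
    schrodingerForm q (fun x => ∑ i ∈ s, c i * e i x) (fun x => ∑ i ∈ s, c i * deriv (e i) x) φ ψ =
      ∑ i ∈ s, μ i * (c i * ∫ x, φ x * e i x) := by
  rw [schrodingerForm_sum s c hq (fun i => (h.solution i).harmonicFormDomain hq₀) hφ]
  refine Finset.sum_congr rfl fun i _ => ?_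
  rw [(h.solution i).schrodingerForm_eq hq hq₀ hφ, mul_left_comm]
  simp only [mul_comm (φ _)]

theorem schrodingerForm_sum_self (hq : Integrable q volume) (hq₀ : ∀ᵐ x, 0 ≤ q x)
    (h : IsOrthonormalEigenfamily q μ e) (s : Finset ι) (c : ι → ℝ) :
    schrodingerForm q (fun x => ∑ i ∈ s, c i * e i x) (fun x => ∑ i ∈ s, c i * deriv (e i) x)
      (fun x => ∑ i ∈ s, c i * e i x) (fun x => ∑ i ∈ s, c i * deriv (e i) x) =
        ∑ i ∈ s, μ i * c i ^ 2 := by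
  rw [h.schrodingerForm_sum_eq hq hq₀ s c (h.harmonicFormDomain_sum hq₀ s c)]
  refine Finset.sum_congr rfl fun i hi => ?_
  rw [h.integral_sum_mul_eq s c hi, pow_two]

theorem sum_mul_sq_le_schrodingerForm (hq : Integrable q volume) (hq₀ : ∀ᵐ x, 0 ≤ q x)
    (h : IsOrthonormalEigenfamily q μ e) (s : Finset ι) (hφ : HarmonicFormDomain φ ψ) :
    ∑ i ∈ s, μ i * (∫ x, φ x * e i x) ^ 2 ≤ schrodingerForm q φ ψ φ ψ := by
  set c : ι → ℝ := fun i => ∫ x, φ x * e i x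
  have hcross : schrodingerForm q (fun x => ∑ i ∈ s, c i * e i x)
      (fun x => ∑ i ∈ s, c i * deriv (e i) x) φ ψ = ∑ i ∈ s, μ i * c i ^ 2 := by
    simp only [pow_two]
    exact h.schrodingerForm_sum_eq hq hq₀ s c hφ
  have hself := h.schrodingerForm_sum_self hq hq₀ s c
  have hsub := schrodingerForm_sub_self hq hφ (h.harmonicFormDomain_sum hq₀ s c)
  rw [hcross, hself] at hsub
  linarith [schrodingerForm_self_nonneg (u := fun x => φ x - ∑ i ∈ s, c i * e i x)
    (v := fun x => ψ x - ∑ i ∈ s, c i * deriv (e i) x) hq₀]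

theorem hasSum_sq (hq : Integrable q volume) (hq₀ : ∀ᵐ x, 0 ≤ q x)
    (h : IsOrthonormalEigenfamily q μ e)
    (hμ : schrodingerEigenvalues (fun x => x ^ 2 + q x) ⊆ Set.range μ) {f : ℝ → ℝ}
    (hf : MemLp f 2 volume) : HasSum (fun i => (∫ x, f x * e i x) ^ 2) (∫ x, f x ^ 2) := by
  refine hasSum_sq_integral_mul (fun i => (h.solution i).memLp) h.integral_mul
    (fun g hg hg_orth => ?_) hf
  refine ae_eq_zero_of_forall_integral_mul_eigenfunction_eq_zero hq hq₀ hg fun ν u hu => ?_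
  obtain rfl | hu_ne := eq_or_ne u 0
  · simp
  obtain ⟨i, rfl⟩ := hμ ⟨u, hu, hu_ne⟩
  have he_ne : e i ≠ 0 := fun hzero => by simpa [hzero] using h.integral_mul i i
  obtain ⟨c, rfl⟩ := (h.solution i).exists_smul_eq
    (locallyIntegrable_sq_add hq.locallyIntegrable) (ae_nonneg_sq_add hq₀) hu he_ne
  simp only [Pi.smul_apply, smul_eq_mul, mul_left_comm _ c]
  rw [integral_const_mul, hg_orth i, mul_zero]

end IsOrthonormalEigenfamily

theorem exists_ne_zero_sum_mul_eq_zero {ι κ : Type*} [Fintype ι] [Fintype κ]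
    (hcard : Fintype.card κ < Fintype.card ι) (a : ι → κ → ℝ) :
    ∃ c : ι → ℝ, c ≠ 0 ∧ ∀ j, ∑ i, c i * a i j = 0 := by
  have hker : LinearMap.ker (Fintype.linearCombination ℝ a) ≠ ⊥ :=
    LinearMap.ker_ne_bot_of_finrank_lt (by simpa using hcard)
  obtain ⟨c, hc, hc_ne⟩ := (Submodule.ne_bot_iff _).1 hker
  refine ⟨c, hc_ne, fun j => ?_⟩
  simpa [Fintype.linearCombination_apply] using congrFun (LinearMap.mem_ker.1 hc) j

namespace IsOrthonormalEigenfamily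

section LowerBound

variable {ι : Type*} [DecidableEq ι] [Fintype ι] {q : ℝ → ℝ} {μ : ι → ℝ} {e : ι → ℝ → ℝ} {n : ℕ}

theorem exists_ne_zero_integral_mul_sq_le (hq : Integrable q volume) (hq₀ : ∀ᵐ x, 0 ≤ q x)
    (h : IsOrthonormalEigenfamily q μ e) (hn : n < Fintype.card ι) :
    ∃ c : ι → ℝ, c ≠ 0 ∧
      ∫ x, q x * (∑ i, c i * e i x) ^ 2 ≤ ∑ i, (μ i - (2 * n + 1)) * c i ^ 2 := by
  obtain ⟨c, hc_ne, hc⟩ := exists_ne_zero_sum_mul_eq_zero (κ := Fin n) (by simpa using hn)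
    fun i k => ∫ x, e i x * hermiteFun k x
  refine ⟨c, hc_ne, ?_⟩
  have horth : ∑ k ∈ Finset.range n, (∫ x, (∑ i, c i * e i x) * hermiteFun k x) ^ 2 = 0 :=
    Finset.sum_eq_zero fun k hk => by
      rw [integral_sum_mul Finset.univ c (fun i => (h.solution i).memLp) (memLp_hermiteFun k),
        hc ⟨k, Finset.mem_range.1 hk⟩, zero_pow two_ne_zero]
  have henergy := (h.harmonicFormDomain_sum hq₀ Finset.univ c).energy_ge n
  have hform := h.schrodingerForm_sum_self hq hq₀ Finset.univ c
  rw [(h.harmonicFormDomain_sum hq₀ Finset.univ c).schrodingerForm_self hq] at hform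
  rw [horth, sub_zero, h.integral_sum_sq, Finset.mul_sum] at henergy
  simp only [sub_mul, Finset.sum_sub_distrib]
  linarith

theorem exists_two_mul_add_one_le (hq : Integrable q volume) (hq₀ : ∀ᵐ x, 0 ≤ q x)
    (h : IsOrthonormalEigenfamily q μ e) (hn : n < Fintype.card ι) : ∃ i, 2 * n + 1 ≤ μ i := by
  obtain ⟨c, hc, hle⟩ := h.exists_ne_zero_integral_mul_sq_le hq hq₀ hn
  by_contra! hμ
  obtain ⟨i, hi⟩ := Function.ne_iff.1 hc
  have hneg : ∑ i, (μ i - (2 * n + 1)) * c i ^ 2 < 0 :=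
    Finset.sum_neg' (fun j _ => mul_nonpos_of_nonpos_of_nonneg (sub_neg.2 (hμ j)).le (sq_nonneg _))
      ⟨i, Finset.mem_univ i, mul_neg_of_neg_of_pos (sub_neg.2 (hμ i)) (sq_pos_of_ne_zero hi)⟩
  exact (hle.trans_lt hneg).not_ge
    (integral_nonneg_of_ae (hq₀.mono fun x hx => mul_nonneg hx (sq_nonneg _)))

theorem exists_two_mul_add_one_lt (hq : Integrable q volume) (hq₀ : ∀ᵐ x, 0 ≤ q x)
    (hq_ne : ∫ x, q x ≠ 0) (h : IsOrthonormalEigenfamily q μ e) (hn : n < Fintype.card ι) :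
    ∃ i, 2 * n + 1 < μ i := by
  obtain ⟨c, hc, hle⟩ := h.exists_ne_zero_integral_mul_sq_le hq hq₀ hn
  by_contra! hμ
  have hterm : ∀ i ∈ Finset.univ, (μ i - (2 * n + 1)) * c i ^ 2 ≤ 0 := fun i _ =>
    mul_nonpos_of_nonpos_of_nonneg (sub_nonpos.2 (hμ i)) (sq_nonneg _)
  have hw_nonneg : 0 ≤ ∫ x, q x * (∑ i, c i * e i x) ^ 2 :=
    integral_nonneg_of_ae (hq₀.mono fun x hx => mul_nonneg hx (sq_nonneg _))
  have hzero := (Finset.sum_eq_zero_iff_of_nonpos hterm).1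
    (le_antisymm (Finset.sum_nonpos hterm) (hw_nonneg.trans hle))
  -- Equality forces the combination to be an eigenfunction for the eigenvalue `2 * n + 1`.
  have hw : (∑ i, c i • e i) ∈ schrodingerEigenspace (fun x => x ^ 2 + q x) (2 * n + 1) := by
    refine Submodule.sum_mem _ fun i hi => ?_
    obtain hμi | hci := mul_eq_zero.1 (hzero i hi)
    · exact Submodule.smul_mem _ _ (sub_eq_zero.1 hμi ▸ h.solution i)
    · simp [pow_eq_zero_iff two_ne_zero |>.1 hci]
  have hw_ne : ∑ i, c i • e i ≠ 0 := fun hsum => hc <| funext fun i => by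
    have hcoef := h.integral_sum_mul_eq Finset.univ c (Finset.mem_univ i)
    have hval : ∀ x, ∑ j, c j * e j x = 0 := fun x => by simpa using congrFun hsum x
    simpa [hval] using hcoef.symm
  have hpos := IsSchrodingerL2Solution.integral_potential_mul_sq_pos hq hq₀ hq_ne hw hw_ne
  simp only [Finset.sum_apply, Pi.smul_apply, smul_eq_mul] at hpos
  exact (hpos.trans_le hle).not_ge (Finset.sum_nonpos hterm)

end LowerBound

section HermiteWeight

variable {ι : Type*} [DecidableEq ι] {q : ℝ → ℝ} {μ : ι → ℝ} {e : ι → ℝ → ℝ}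

theorem sum_sq_integral_hermiteFun_mul_le_one (h : IsOrthonormalEigenfamily q μ e)
    (s : Finset ℕ) (i : ι) : ∑ k ∈ s, (∫ x, hermiteFun k x * e i x) ^ 2 ≤ 1 := by
  have hbessel := sum_sq_integral_mul_hermiteFun_le (h.solution i).memLp s
  simpa only [pow_two (e i _), h.integral_mul, if_true, mul_comm (e i _) (hermiteFun _ _)]
    using hbessel

theorem hasSum_sum_sq_integral_hermiteFun_mul (hq : Integrable q volume) (hq₀ : ∀ᵐ x, 0 ≤ q x)
    (h : IsOrthonormalEigenfamily q μ e)
    (hμ : schrodingerEigenvalues (fun x => x ^ 2 + q x) ⊆ Set.range μ) (s : Finset ℕ) :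
    HasSum (fun i => ∑ k ∈ s, (∫ x, hermiteFun k x * e i x) ^ 2) s.card := by
  have hsum := hasSum_sum (s := s) fun k _ => h.hasSum_sq hq hq₀ hμ (memLp_hermiteFun k)
  simpa [pow_two (hermiteFun _ _), integral_hermiteFun_mul_hermiteFun] using hsum

end HermiteWeight

end IsOrthonormalEigenfamily

section Spectrum

variable {q : ℝ → ℝ}

theorem finite_schrodingerEigenvalues_inter_Iio (hq : Integrable q volume)
    (hq₀ : ∀ᵐ x, 0 ≤ q x) (M : ℝ) :
    (schrodingerEigenvalues (fun x => x ^ 2 + q x) ∩ Set.Iio M).Finite := by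
  by_contra hinf
  obtain ⟨n, hn⟩ := exists_nat_ge M
  obtain ⟨s, hs, hcard⟩ := Set.Infinite.exists_subset_card_eq hinf (n + 1)
  obtain ⟨e, he⟩ := IsOrthonormalEigenfamily.exists_of_injective hq hq₀
    (μ := fun i : s => (i : ℝ)) Subtype.val_injective fun i => (hs i.2).1
  obtain ⟨i, hi⟩ := he.exists_two_mul_add_one_le hq hq₀ (n := n) (by simp [hcard])
  have hiM : (i : ℝ) < M := (hs i.2).2
  linarith [n.cast_nonneg (α := ℝ)]

theorem infinite_schrodingerEigenvalues (hq : Integrable q volume) (hq₀ : ∀ᵐ x, 0 ≤ q x) :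
    (schrodingerEigenvalues fun x => x ^ 2 + q x).Infinite := by
  classical
  intro hfin
  let _ := hfin.fintype
  obtain ⟨e, he⟩ := IsOrthonormalEigenfamily.exists_of_injective hq hq₀
    (μ := fun i : schrodingerEigenvalues (fun x => x ^ 2 + q x) => (i : ℝ))
    Subtype.val_injective fun i => i.2
  set N := Fintype.card (schrodingerEigenvalues fun x => x ^ 2 + q x)
  have htrace := (hasSum_fintype _).unique
    (he.hasSum_sum_sq_integral_hermiteFun_mul hq hq₀ (by simp) (Finset.range (N + 1)))
  have hle : (N + 1 : ℝ) ≤ N := calc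
    (N + 1 : ℝ) = ∑ i, ∑ k ∈ Finset.range (N + 1), (∫ x, hermiteFun k x * e i x) ^ 2 := by
      simp [htrace]
    _ ≤ ∑ _ : schrodingerEigenvalues (fun x => x ^ 2 + q x), (1 : ℝ) :=
      Finset.sum_le_sum fun i _ => he.sum_sq_integral_hermiteFun_mul_le_one _ i
    _ = N := by simp [N]
  linarith

theorem two_mul_add_one_lt_of_strictMono (hq : Integrable q volume) (hq₀ : ∀ᵐ x, 0 ≤ q x)
    (hq_ne : ∫ x, q x ≠ 0) {lam : ℕ → ℝ} (hlam : StrictMono lam)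
    (hmem : ∀ k, lam k ∈ schrodingerEigenvalues fun x => x ^ 2 + q x) (n : ℕ) :
    2 * n + 1 < lam n := by
  obtain ⟨e, he⟩ := IsOrthonormalEigenfamily.exists_of_injective hq hq₀
    (μ := fun k : Fin (n + 1) => lam k) (hlam.injective.comp Fin.val_injective) fun k => hmem k
  obtain ⟨k, hk⟩ := he.exists_two_mul_add_one_lt hq hq₀ hq_ne (n := n) (by simp)
  exact hk.trans_le (hlam.monotone (Nat.lt_succ_iff.1 k.2))

end Spectrum

theorem sum_range_le_of_monotone_of_hasSum {lam P : ℕ → ℝ} {m : ℕ} {B : ℝ}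
    (hlam : Monotone lam) (hP_nonneg : ∀ j, 0 ≤ P j) (hP_le_one : ∀ j, P j ≤ 1)
    (hP : HasSum P m) (hB : ∀ s : Finset ℕ, ∑ j ∈ s, lam j * P j ≤ B) :
    ∑ j ∈ Finset.range m, lam j ≤ B := by
  have hbound : ∀ M ≥ m,
      ∑ j ∈ Finset.range m, lam j + lam m * (∑ j ∈ Finset.range M, P j - m) ≤ B := by
    intro M hM
    have hhead : ∑ j ∈ Finset.range m, lam j * (1 - P j) ≤
        ∑ j ∈ Finset.range m, lam m * (1 - P j) := Finset.sum_le_sum fun j hj =>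
      mul_le_mul_of_nonneg_right (hlam (Finset.mem_range.1 hj).le) (sub_nonneg.2 (hP_le_one j))
    have htail : ∑ j ∈ Finset.Ico m M, lam m * P j ≤ ∑ j ∈ Finset.Ico m M, lam j * P j :=
      Finset.sum_le_sum fun j hj =>
        mul_le_mul_of_nonneg_right (hlam (Finset.mem_Ico.1 hj).1) (hP_nonneg j)
    refine le_trans ?_ (hB (Finset.range M))
    rw [← Finset.sum_range_add_sum_Ico _ hM, ← Finset.sum_range_add_sum_Ico _ hM]
    simp only [mul_sub, mul_one, Finset.sum_sub_distrib, ← Finset.mul_sum, Finset.sum_const,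
      Finset.card_range, nsmul_eq_mul] at hhead htail
    linarith
  have hlim := ((hP.tendsto_sum_nat.sub_const (m : ℝ)).const_mul (lam m)).const_add
    (∑ j ∈ Finset.range m, lam j)
  rw [sub_self, mul_zero, add_zero] at hlim
  exact le_of_tendsto hlim (eventually_atTop.2 ⟨m, hbound⟩)

theorem sum_schrodingerForm_hermiteFun_le {q : ℝ → ℝ} (hq : Integrable q volume)
    (hq₀ : ∀ᵐ x, 0 ≤ q x) (n : ℕ) :
    ∑ k ∈ Finset.range (n + 1), schrodingerForm q (hermiteFun k) (deriv (hermiteFun k))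
        (hermiteFun k) (deriv (hermiteFun k)) ≤
      ∑ k ∈ Finset.range (n + 1), (2 * k + 1 : ℝ) + omegaConst n / Real.pi * ∫ x, q x := by
  have hint : ∀ k ∈ Finset.range (n + 1), Integrable (fun x => q x * hermiteFun k x ^ 2) volume :=
    fun k _ => by
      simpa only [pow_two] using
        (harmonicFormDomain_hermiteFun k).integrable_mul_mul (harmonicFormDomain_hermiteFun k) hq
  have hpotential : ∑ k ∈ Finset.range (n + 1), ∫ x, q x * hermiteFun k x ^ 2 ≤
      omegaConst n / Real.pi * ∫ x, q x := by
    rw [← integral_finsetSum _ hint, ← integral_const_mul]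
    refine integral_mono_ae (integrable_finsetSum _ hint) (hq.const_mul _) ?_
    filter_upwards [hq₀] with x hx
    rw [← Finset.mul_sum, mul_comm]
    exact mul_le_mul_of_nonneg_right (sum_hermiteFun_sq_le n x) hx
  simp only [(harmonicFormDomain_hermiteFun _).schrodingerForm_self hq, hermiteFun_energy,
    Finset.sum_add_distrib (g := fun k => ∫ x, q x * hermiteFun k x ^ 2)]
  exact add_le_add_right hpotential _

theorem IsOrthonormalEigenfamily.sum_sub_le {q : ℝ → ℝ} {lam : ℕ → ℝ} {e : ℕ → ℝ → ℝ}
    (hq : Integrable q volume) (hq₀ : ∀ᵐ x, 0 ≤ q x) (h : IsOrthonormalEigenfamily q lam e)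
    (hlam : Monotone lam)
    (hrange : schrodingerEigenvalues (fun x => x ^ 2 + q x) ⊆ Set.range lam) (n : ℕ) :
    ∑ k ∈ Finset.range (n + 1), (lam k - (2 * k + 1)) ≤ omegaConst n / Real.pi * ∫ x, q x := by
  rw [Finset.sum_sub_distrib, sub_le_iff_le_add']
  refine le_trans ?_ (sum_schrodingerForm_hermiteFun_le hq hq₀ n)
  have hweight := h.hasSum_sum_sq_integral_hermiteFun_mul hq hq₀ hrange (Finset.range (n + 1))
  rw [Finset.card_range] at hweight
  refine sum_range_le_of_monotone_of_hasSum hlam (fun j => Finset.sum_nonneg fun k _ => sq_nonneg _)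
    (h.sum_sq_integral_hermiteFun_mul_le_one _) hweight fun s => ?_
  simp only [Finset.mul_sum]
  rw [Finset.sum_comm]
  exact Finset.sum_le_sum fun k _ =>
    h.sum_mul_sq_le_schrodingerForm hq hq₀ s (harmonicFormDomain_hermiteFun k)

theorem exists_strictMono_range_eq {S : Set ℝ} (hinf : S.Infinite)
    (hfin : ∀ M, (S ∩ Set.Iio M).Finite) :
    ∃ lam : ℕ → ℝ, StrictMono lam ∧ Set.range lam = S ∧ Tendsto lam atTop atTop := by
  have hfin_le : ∀ M, (S ∩ Set.Iic M).Finite := fun M => (hfin (M + 1)).subset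
    (Set.inter_subset_inter_right S (Set.Iic_subset_Iio.2 (lt_add_one M)))
  let _ : LocallyFiniteOrder S := LocallyFiniteOrder.ofFiniteIcc fun a b =>
    .of_finite_image ((hfin_le b).subset (by rintro _ ⟨x, hx, rfl⟩; exact ⟨x.2, hx.2⟩))
      Subtype.val_injective.injOn
  let _ : SuccOrder S := LinearLocallyFiniteOrder.succOrder S
  let _ : PredOrder S := LinearLocallyFiniteOrder.predOrder S
  obtain ⟨y, hy⟩ := hinf.nonempty
  obtain ⟨m, hm, hmin⟩ := (hfin_le y).exists_minimal ⟨y, hy, Set.mem_Iic.2 le_rfl⟩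
  let _ : OrderBot S :=
    { bot := ⟨m, hm.1⟩
      bot_le := fun x => (le_total m x).elim id fun h => hmin ⟨x.2, h.trans hm.2⟩ h }
  have : NoMaxOrder S := ⟨fun a => by
    by_contra! hmax
    exact hinf ((hfin_le a).subset fun x hx => ⟨hx, hmax ⟨x, hx⟩⟩)⟩
  let f : ℕ ≃o S := orderIsoNatOfLinearSuccPredArch.symm
  have hmono : StrictMono fun k => (f k : ℝ) := f.strictMono
  have hrange : Set.range (fun k => (f k : ℝ)) = S := by
    rw [Set.range_comp' Subtype.val f, f.surjective.range_eq, Set.image_univ, Subtype.range_val]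
  refine ⟨_, hmono, hrange, tendsto_atTop_atTop_of_monotone hmono.monotone fun M => ?_⟩
  by_contra! hbdd
  refine Set.infinite_range_of_injective hmono.injective ((hfin M).subset ?_)
  rintro _ ⟨k, rfl⟩
  exact ⟨(f k).2, hbdd k⟩

theorem cardinal_eq_of_le_one_of_ne_zero_iff {a b : Cardinal} (ha : a ≤ 1) (hb : b ≤ 1)
    (hab : a ≠ 0 ↔ b ≠ 0) : a = b := by
  by_cases ha_zero : a = 0
  · rw [ha_zero, not_ne_iff.1 (mt hab.2 (not_ne_iff.2 ha_zero))]
  · rw [le_antisymm ha (Cardinal.one_le_iff_ne_zero.2 ha_zero),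
      le_antisymm hb (Cardinal.one_le_iff_ne_zero.2 (hab.1 ha_zero))]

theorem rank_schrodingerEigenspace_ne_zero_iff {V : ℝ → ℝ} {μ : ℝ} :
    Module.rank ℝ (schrodingerEigenspace V μ) ≠ 0 ↔ μ ∈ schrodingerEigenvalues V := by
  rw [Ne, Submodule.rank_eq_zero, ← Ne, Submodule.ne_bot_iff]
  rfl

theorem isSchrodingerEigenvalueSequence_iff {V : ℝ → ℝ} {lam : ℕ → ℝ}
    (hV : LocallyIntegrable V volume) (hV₀ : ∀ᵐ x, 0 ≤ V x) :
    IsSchrodingerEigenvalueSequence V lam ↔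
      StrictMono lam ∧ Set.range lam = schrodingerEigenvalues V ∧ Tendsto lam atTop atTop := by
  have hrank := IsSchrodingerL2Solution.rank_eigenspace_le_one hV hV₀
  constructor
  · intro h
    have hinj : Function.Injective lam := fun i j hij => by
      have hone : Cardinal.mk {k : ℕ // lam k = lam j} ≤ 1 := h.multiplicity _ ▸ hrank _
      have hsub := Cardinal.le_one_iff_subsingleton.1 hone
      exact congrArg Subtype.val (Subsingleton.elim (⟨i, hij⟩ : {k // lam k = lam j}) ⟨j, rfl⟩)
    refine ⟨h.monotone.strictMono_of_injective hinj, Set.ext fun μ => ?_, h.tendsto_atTop⟩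
    rw [← rank_schrodingerEigenspace_ne_zero_iff, ← h.multiplicity, Cardinal.mk_ne_zero_iff,
      nonempty_subtype, Set.mem_range]
  · rintro ⟨hmono, hrange, htop⟩
    refine ⟨hmono.monotone, htop, fun μ => ?_⟩
    have hsub : Subsingleton {k // lam k = μ} :=
      ⟨fun i j => Subtype.ext (hmono.injective (i.2.trans j.2.symm))⟩
    refine cardinal_eq_of_le_one_of_ne_zero_iff (Cardinal.le_one_iff_subsingleton.2 hsub) (hrank μ)
      ?_
    rw [rank_schrodingerEigenspace_ne_zero_iff, ← hrange, Cardinal.mk_ne_zero_iff,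
      nonempty_subtype, Set.mem_range]

theorem rpow_neg_sum_mul_le_sum_mul_rpow_neg {ι : Type*} {t : Finset ι} {w a : ι → ℝ} {s : ℝ}
    (hw : ∀ i ∈ t, 0 ≤ w i) (hw_sum : ∑ i ∈ t, w i = 1) (ha : ∀ i ∈ t, 0 < a i) (hs : 0 ≤ s) :
    (∑ i ∈ t, w i * a i) ^ (-s) ≤ ∑ i ∈ t, w i * a i ^ (-s) := calc
  (∑ i ∈ t, w i * a i) ^ (-s) ≤ (∏ i ∈ t, a i ^ w i) ^ (-s) :=
    Real.rpow_le_rpow_of_nonpos (Finset.prod_pos fun i hi => Real.rpow_pos_of_pos (ha i hi) _)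
      (Real.geom_mean_le_arith_mean_weighted t w a hw hw_sum fun i hi => (ha i hi).le)
      (neg_nonpos.2 hs)
  _ = ∏ i ∈ t, (a i ^ (-s)) ^ w i := by
    rw [← Real.finsetProd_rpow _ _ fun i hi => Real.rpow_nonneg (ha i hi).le _]
    refine Finset.prod_congr rfl fun i hi => ?_
    rw [← Real.rpow_mul (ha i hi).le, ← Real.rpow_mul (ha i hi).le, mul_comm]
  _ ≤ ∑ i ∈ t, w i * a i ^ (-s) :=
    Real.geom_mean_le_arith_mean_weighted t w _ hw hw_sum fun i hi =>
      Real.rpow_nonneg (ha i hi).le _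

theorem rpow_neg_le_average_rpow_neg {n : ℕ} {a : ℕ → ℝ} {B s : ℝ} (ha : ∀ k, 0 < a k)
    (hs : 0 ≤ s) (hB : ∑ k ∈ Finset.range (n + 1), a k ≤ (n + 1) * B) :
    B ^ (-s) ≤ 1 / ((n : ℝ) + 1) * ∑ k ∈ Finset.range (n + 1), a k ^ (-s) := by
  have hn : (0 : ℝ) < n + 1 := n.cast_add_one_pos
  have hjensen := rpow_neg_sum_mul_le_sum_mul_rpow_neg (t := Finset.range (n + 1))
    (w := fun _ => 1 / ((n : ℝ) + 1)) (fun _ _ => by positivity) (by simp [hn.ne'])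
    (fun k _ => ha k) hs
  rw [← Finset.mul_sum, ← Finset.mul_sum, one_div_mul_eq_div] at hjensen
  refine le_trans (Real.rpow_le_rpow_of_nonpos ?_ ?_ (neg_nonpos.2 hs)) hjensen
  · exact div_pos (Finset.sum_pos (fun k _ => ha k) Finset.nonempty_range_add_one) hn
  · rwa [div_le_iff₀' hn]

theorem theorem6p1 (q : ℝ → ℝ) (hq_int : Integrable q volume)
    (hq_nonneg : ∀ᵐ x : ℝ, 0 ≤ q x) (hq_ne : (∫ x : ℝ, q x) ≠ 0) :
    (∃ lam : ℕ → ℝ, IsSchrodingerEigenvalueSequence (fun x => x ^ 2 + q x) lam) ∧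
    ∀ lam : ℕ → ℝ, IsSchrodingerEigenvalueSequence (fun x => x ^ 2 + q x) lam →
      (∀ k : ℕ, 0 < lam k - harmonicEigenvalue k) ∧
      ∀ (n : ℕ) (s : ℝ), 0 < s →
        1 / ((n : ℝ) + 1) *
            ∑ k ∈ Finset.range (n + 1), (lam k - harmonicEigenvalue k) ^ (-s) ≥
          (omegaConst n / (((n : ℝ) + 1) * Real.pi) * ∫ x : ℝ, q x) ^ (-s) := by
  have hiff (lam : ℕ → ℝ) := isSchrodingerEigenvalueSequence_iff (lam := lam)
    (locallyIntegrable_sq_add hq_int.locallyIntegrable) (ae_nonneg_sq_add hq_nonneg)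
  refine ⟨?_, fun lam hlam => ?_⟩
  · obtain ⟨lam, hlam⟩ := exists_strictMono_range_eq
      (infinite_schrodingerEigenvalues hq_int hq_nonneg)
      (finite_schrodingerEigenvalues_inter_Iio hq_int hq_nonneg)
    exact ⟨lam, (hiff lam).2 hlam⟩
  · obtain ⟨hmono, hrange, -⟩ := (hiff lam).1 hlam
    have hmem : ∀ k, lam k ∈ schrodingerEigenvalues fun x => x ^ 2 + q x := fun k =>
      hrange ▸ Set.mem_range_self k
    obtain ⟨e, he⟩ := IsOrthonormalEigenfamily.exists_of_injective hq_int hq_nonneg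
      hmono.injective hmem
    have hgap : ∀ k, 0 < lam k - harmonicEigenvalue k := fun k =>
      sub_pos.2 (two_mul_add_one_lt_of_strictMono hq_int hq_nonneg hq_ne hmono hmem k)
    refine ⟨hgap, fun n s hs => rpow_neg_le_average_rpow_neg hgap hs.le ?_⟩
    refine (he.sum_sub_le hq_int hq_nonneg hmono.monotone hrange.ge n).trans_eq ?_
    field_simp
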